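/- **Problems.** All data are rational; dimensions are arbitrary (zero allowed), and $\|u\|_0$ is the number of nonzero entries of $u$. - *Exact dictionary representation* (EDR): an instance is $\langle D,s\rangle$ with $D\in\mathbb{Q}^{m\times n}$ and $s\in\mathrm{col}(D)$. The solutions are the $v\in\mathbb{Q}^n$ with $Dv=s$; minimize $\|v\|_0$. - *Min unsatisfy* (MU): an instance is $\langle A,y\rangle$ with $A\in\mathbb{Q}^{m\times n}$ and $y\in\mathbb{Q}^m$. The solutions are all $x\in\mathbb{Q}^n$; minimize $\|y-Ax\|_0$. **Exact reductions.** Let $F$ and $G$ be minimization problems, where $S_F(x)$ is the set of solutions of the instance $x$, $M_F(x,y)$ is the measure of the solution $y\in S_F(x)$, and $\|F(x)\|=\min_{y\in S_F(x)}M_F(x,y)$. An *exact reduction* from $F$ to $G$ is a pair $\langle t_1,t_2\rangle$ of polynomial-time computable maps such that 1. $t_1$ maps instances of $F$ to instances of $G$, and $t_2(x,y)\in S_F(x)$ for every instance $x$ of $F$ and every $y\in S_G(t_1(x))$; 2. $M_F(x,t_2(x,y))=M_G(t_1(x),y)$ for all such $x,y$; 3. $\|F(x)\|\ge\|G(t_1(x))\|$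 for every instance $x$ of $F$. Write $F\preceq G$ if such a pair exists. The problems are *(approximation-)equivalent*, $F\sim G$, if $F\preceq G$ and $G\preceq F$. Polynomial time means time polynomial in the bit length of the input (rationals are given in lowest terms, dimensions count as if written in unary), measured on a random access machine under the logarithmic cost criterion. A matrix $N$ is a *full null matrix* for a matrix $A$ with $n$ columns if $AN=0$ and $\mathrm{rank}(N)=n-\mathrm{rank}(A)$. **Lemma.** Exact dictionary representation and min unsatisfy are equivalent: $\mathrm{EDR}\sim\mathrm{MU}$. Moreover, the reductions can be chosen of the following form. - There is an exact reduction $\langle t_1,t_2\rangle$ from EDR to MU with $t_1(\langle D,s\rangle)=\langle A,y\rangle$ and $t_2(\langle D,s\rangle,x)=y-Ax$, where $A$ is a full null matrix for $D$ and $y$ satisfies $Dy=s$. - There is an exact reduction $\langle t_1,t_2\rangle$ from MU to EDR with $t_1(\langle A,y\rangle)=\langle D,Dy\rangle$, where $A$ is a full null matrix for $D$, and such that $x=t_2(\langle A,y\rangle,v)$ satisfies $Ax=y-v$. -/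

import Mathlib

open Matrix

/-! ## Polynomial time: a random access machine with structured control and logarithmic cost

A program works on finitely many integer variables, finitely many integer arrays with random
access, and a write-only output tape.  Every operation is charged the bit lengths of all integers
it touches (addresses, operands and results): the logarithmic cost criterion, under which
polynomial time on such machines is polynomial time on Turing machines. -/

namespace RAM

/-- Bit length of an integer, with one unit for the sign. -/
def bitLen (z : ℤ) : ℕ := Nat.size z.natAbs + 1

/-- Total bit length of a word of integers. -/
def wordSize (w : List ℤ) : ℕ := (w.map bitLen).sum

/-- A machine configuration: variables, arrays (array `a` at address `i` is `arr a i`), and what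
has been written to the output tape so far. -/
structure State where
  var : ℕ → ℤ
  arr : ℕ → ℤ → ℤ
  out : List ℤ

/-- Arithmetic expressions; `div` is integer division and `get a e` reads array `a` at
address `e`. -/
inductive Expr where
  | const (c : ℤ)
  | var (x : ℕ)
  | get (a : ℕ) (e : Expr)
  | add (e₁ e₂ : Expr)
  | sub (e₁ e₂ : Expr)
  | mul (e₁ e₂ : Expr)
  | div (e₁ e₂ : Expr)

/-- The value of an expression. -/
def Expr.eval (σ : State) : Expr → ℤ
  | .const c => c
  | .var x => σ.var x
  | .get a e => σ.arr a (e.eval σ)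
  | .add e₁ e₂ => e₁.eval σ + e₂.eval σ
  | .sub e₁ e₂ => e₁.eval σ - e₂.eval σ
  | .mul e₁ e₂ => e₁.eval σ * e₂.eval σ
  | .div e₁ e₂ => e₁.eval σ / e₂.eval σ

/-- The logarithmic cost of evaluating an expression: the sum of the bit lengths of the values of
all its subexpressions. -/
def Expr.cost (σ : State) : Expr → ℕ
  | .const c => bitLen c
  | .var x => bitLen (σ.var x)
  | .get a e => e.cost σ + bitLen (σ.arr a (e.eval σ))
  | .add e₁ e₂ => e₁.cost σ + e₂.cost σ + bitLen (e₁.eval σ + e₂.eval σ)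
  | .sub e₁ e₂ => e₁.cost σ + e₂.cost σ + bitLen (e₁.eval σ - e₂.eval σ)
  | .mul e₁ e₂ => e₁.cost σ + e₂.cost σ + bitLen (e₁.eval σ * e₂.eval σ)
  | .div e₁ e₂ => e₁.cost σ + e₂.cost σ + bitLen (e₁.eval σ / e₂.eval σ)

/-- Programs. `store a i e` puts `e` into array `a` at address `i`; `write e` appends `e` to the
output; `ifPos e p q` and `whilePos e p` test whether `0 < e`. -/
inductive Prog where
  | skip
  | assign (x : ℕ) (e : Expr)
  | store (a : ℕ) (i e : Expr)
  | write (e : Expr)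
  | seq (p q : Prog)
  | ifPos (e : Expr) (p q : Prog)
  | whilePos (e : Expr) (p : Prog)

def State.setVar (σ : State) (x : ℕ) (v : ℤ) : State :=
  { σ with var := Function.update σ.var x v }

def State.setArr (σ : State) (a : ℕ) (i v : ℤ) : State :=
  { σ with arr := Function.update σ.arr a (Function.update (σ.arr a) i v) }

def State.write (σ : State) (v : ℤ) : State :=
  { σ with out := σ.out ++ [v] }

/-- `Runs p σ σ' t`: started in `σ`, the program `p` halts in `σ'` after time `t`. -/
inductive Runs : Prog → State → State → ℕ → Prop where
  | skip (σ : State) : Runs .skip σ σ 1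
  | assign (x : ℕ) (e : Expr) (σ : State) :
      Runs (.assign x e) σ (σ.setVar x (e.eval σ)) (1 + e.cost σ)
  | store (a : ℕ) (i e : Expr) (σ : State) :
      Runs (.store a i e) σ (σ.setArr a (i.eval σ) (e.eval σ)) (1 + i.cost σ + e.cost σ)
  | write (e : Expr) (σ : State) :
      Runs (.write e) σ (σ.write (e.eval σ)) (1 + e.cost σ)
  | seq {p q : Prog} {σ σ' σ'' : State} {t t' : ℕ} :
      Runs p σ σ' t → Runs q σ' σ'' t' → Runs (.seq p q) σ σ'' (t + t')
  | ifTrue {e : Expr} {p q : Prog} {σ σ' : State} {t : ℕ} :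
      0 < e.eval σ → Runs p σ σ' t → Runs (.ifPos e p q) σ σ' (1 + e.cost σ + t)
  | ifFalse {e : Expr} {p q : Prog} {σ σ' : State} {t : ℕ} :
      ¬ 0 < e.eval σ → Runs q σ σ' t → Runs (.ifPos e p q) σ σ' (1 + e.cost σ + t)
  | whileTrue {e : Expr} {p : Prog} {σ σ' σ'' : State} {t t' : ℕ} :
      0 < e.eval σ → Runs p σ σ' t → Runs (.whilePos e p) σ' σ'' t' →
        Runs (.whilePos e p) σ σ'' (1 + e.cost σ + t + t')
  | whileFalse {e : Expr} {p : Prog} {σ : State} :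
      ¬ 0 < e.eval σ → Runs (.whilePos e p) σ σ (1 + e.cost σ)

/-- The initial configuration on input `w`: the length of `w` is in variable `0`, the letters of
`w` are in array `0` from address `0` on, everything else is `0` and the output is empty. -/
def init (w : List ℤ) : State where
  var x := if x = 0 then (w.length : ℤ) else 0
  arr a i := if a = 0 ∧ 0 ≤ i then w.getD i.toNat 0 else 0
  out := []

/-- One program turns the input word `input a` into the output word `output a`, for every `a`, in
time polynomial in the bit length of the input word. -/
def PolyTime {α : Type} (input output : α → List ℤ) : Prop :=
  ∃ (p : Prog) (q : Polynomial ℕ), ∀ a : α, ∃ (σ : State) (t : ℕ),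
    Runs p (init (input a)) σ t ∧ σ.out = output a ∧ t ≤ q.eval (wordSize (input a))

/-- The encoding of a pair of words. -/
def encPair (u v : List ℤ) : List ℤ := (u.length : ℤ) :: (u ++ v)

/-- A list of rationals, each in lowest terms as numerator and positive denominator. -/
def encRats (l : List ℚ) : List ℤ := l.flatMap fun q => [q.num, (q.den : ℤ)]

/-- A vector: its length, then its entries. -/
def encVec {n : ℕ} (v : Fin n → ℚ) : List ℤ := (n : ℤ) :: encRats (List.ofFn v)

/-- A matrix: its dimensions, then `m + n` padding zeros, then its entries row by row.  The padding
makes the code at least as long as with dimensions in unary, which matters only for matrices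
without rows or without columns. -/
def encMat {m n : ℕ} (A : Matrix (Fin m) (Fin n) ℚ) : List ℤ :=
  (m : ℤ) :: (n : ℤ) :: (List.replicate (m + n) 0 ++
    encRats (List.ofFn fun i => List.ofFn fun j => A i j).flatten)

theorem length_encRats (l : List ℚ) : (encRats l).length = 2 * l.length := by
  induction l with
  | nil => rfl
  | cons q l ih =>
    simp only [encRats, List.flatMap_cons, List.length_append, List.length_cons,
      List.length_nil] at ih ⊢
    omega

theorem encRats_injective : Function.Injective encRats := by
  intro l
  induction l with
  | nil =>
    intro l' h
    cases l' with
    | nil => rfl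
    | cons q l' => simp [encRats] at h
  | cons q l ih =>
    intro l' h
    cases l' with
    | nil => simp [encRats] at h
    | cons q' l' =>
      simp only [encRats, List.flatMap_cons, List.cons_append, List.nil_append,
        List.cons.injEq] at h
      obtain ⟨h₁, h₂, h₃⟩ := h
      rw [ih h₃, Rat.ext h₁ (by exact_mod_cast h₂)]

theorem encVec_injective {n : ℕ} : Function.Injective (encVec (n := n)) := by
  intro v w h
  simp only [encVec, List.cons.injEq, true_and] at h
  exact List.ofFn_injective (encRats_injective h)

theorem length_encMat {m n : ℕ} (A : Matrix (Fin m) (Fin n) ℚ) :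
    (encMat A).length = 2 + (m + n) + 2 * (m * n) := by
  have : (List.ofFn fun i => List.ofFn fun j => A i j).flatten.length = m * n := by
    simp [List.length_flatten, List.map_ofFn, Function.comp_def]
  simp only [encMat, List.length_cons, List.length_append, List.length_replicate,
    length_encRats, this]
  omega

theorem encMat_injective {m n : ℕ} : Function.Injective (encMat (m := m) (n := n)) := by
  intro A B h
  simp only [encMat, List.cons.injEq, true_and, List.append_cancel_left_eq] at h
  have h' := encRats_injective h
  have h'' : (List.ofFn fun i => List.ofFn fun j => A i j)
      = List.ofFn fun i => List.ofFn fun j => B i j := by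
    rw [List.eq_iff_flatten_eq]
    exact ⟨h', by simp [List.map_ofFn, Function.comp_def]⟩
  ext i j
  exact congrFun (List.ofFn_injective (congrFun (List.ofFn_injective h'') i)) j

/-- The code of a matrix followed by a vector with as many entries as the matrix has rows. -/
def encSystem {m n : ℕ} (A : Matrix (Fin m) (Fin n) ℚ) (b : Fin m → ℚ) : List ℤ :=
  encMat A ++ encRats (List.ofFn b)

theorem encSystem_dims {m n m' n' : ℕ} {A : Matrix (Fin m) (Fin n) ℚ} {b : Fin m → ℚ}
    {A' : Matrix (Fin m') (Fin n') ℚ} {b' : Fin m' → ℚ}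
    (h : encSystem A b = encSystem A' b') : m = m' ∧ n = n' := by
  simp only [encSystem, encMat, List.cons_append, List.cons.injEq, Nat.cast_inj] at h
  exact ⟨h.1, h.2.1⟩

theorem encSystem_inj {m n : ℕ} {A A' : Matrix (Fin m) (Fin n) ℚ} {b b' : Fin m → ℚ}
    (h : encSystem A b = encSystem A' b') : A = A' ∧ b = b' := by
  have h' := List.append_inj h (by rw [length_encMat, length_encMat])
  exact ⟨encMat_injective h'.1, List.ofFn_injective (encRats_injective h'.2)⟩

end RAM

/-! ## Minimization problems and exact reductions -/

/-- A minimization problem with integer measure, together with encodings of its instances and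
solutions as words of integers. -/
structure MinProblem where
  /-- the input instances -/
  Inst : Type
  /-- the solution space of an instance -/
  Sol : Inst → Type
  sol_nonempty : ∀ x, Nonempty (Sol x)
  /-- the objective metric -/
  metric : ∀ x, Sol x → ℕ
  encInst : Inst → List ℤ
  encInst_injective : Function.Injective encInst
  encSol : ∀ x, Sol x → List ℤ
  encSol_injective : ∀ x, Function.Injective (encSol x)

namespace MinProblem

/-- The optimal value of an instance; it is attained, as the set is a nonempty set of natural
numbers. -/
noncomputable def opt (F : MinProblem) (x : F.Inst) : ℕ := sInf (Set.range (F.metric x))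

/-- `⟨t₁, t₂⟩` is an exact reduction from `F` to `G`.  That `t₂ x y` is a solution of `x` for every
solution `y` of `t₁ x` is expressed by its type. -/
structure IsExactReduction (F G : MinProblem) (t₁ : F.Inst → G.Inst)
    (t₂ : ∀ x : F.Inst, G.Sol (t₁ x) → F.Sol x) : Prop where
  polyTime_fst : RAM.PolyTime F.encInst fun x => G.encInst (t₁ x)
  polyTime_snd : RAM.PolyTime
    (fun p : (x : F.Inst) × G.Sol (t₁ x) => RAM.encPair (F.encInst p.1) (G.encSol (t₁ p.1) p.2))
    (fun p => F.encSol p.1 (t₂ p.1 p.2))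
  metric_eq : ∀ (x : F.Inst) (y : G.Sol (t₁ x)), F.metric x (t₂ x y) = G.metric (t₁ x) y
  opt_le : ∀ x : F.Inst, G.opt (t₁ x) ≤ F.opt x

/-- `F ⪯ G`: there is an exact reduction from `F` to `G`. -/
def Reduces (F G : MinProblem) : Prop :=
  ∃ (t₁ : F.Inst → G.Inst) (t₂ : ∀ x : F.Inst, G.Sol (t₁ x) → F.Sol x), IsExactReduction F G t₁ t₂

/-- `F ∼ G`: each problem has an exact reduction to the other. -/
def Equivalent (F G : MinProblem) : Prop := Reduces F G ∧ Reduces G F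

end MinProblem

/-! ## The two vector problems -/

/-- An instance `⟨D, s⟩` of exact dictionary representation: `s` is in the column span of `D`. -/
structure EDRInst where
  m : ℕ
  n : ℕ
  D : Matrix (Fin m) (Fin n) ℚ
  s : Fin m → ℚ
  mem : s ∈ Submodule.span ℚ (Set.range D.col)

/-- An instance `⟨A, y⟩` of min unsatisfy. -/
structure MUInst where
  m : ℕ
  n : ℕ
  A : Matrix (Fin m) (Fin n) ℚ
  y : Fin m → ℚ

/-- The instance `⟨D, D y⟩` of exact dictionary representation. -/
def EDRInst.ofVec {m n : ℕ} (D : Matrix (Fin m) (Fin n) ℚ) (y : Fin n → ℚ) : EDRInst where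
  m := m
  n := n
  D := D
  s := D *ᵥ y
  mem := by
    rw [← Matrix.range_mulVecLin]
    exact ⟨y, rfl⟩

/-- Exact dictionary representation: given `⟨D, s⟩`, minimize `‖v‖₀` over all rational `v` with
`D v = s`. -/
def EDR : MinProblem where
  Inst := EDRInst
  Sol I := {v : Fin I.n → ℚ // I.D *ᵥ v = I.s}
  sol_nonempty I := by
    have h := I.mem
    rw [← Matrix.range_mulVecLin] at h
    obtain ⟨v, hv⟩ := h
    exact ⟨⟨v, hv⟩⟩
  metric _ v := hammingNorm v.1
  encInst I := RAM.encSystem I.D I.s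
  encInst_injective := by
    rintro ⟨m, n, D, s, hs⟩ ⟨m', n', D', s', hs'⟩ h
    obtain ⟨rfl, rfl⟩ := RAM.encSystem_dims h
    obtain ⟨rfl, rfl⟩ := RAM.encSystem_inj h
    rfl
  encSol _ v := RAM.encVec v.1
  encSol_injective _ := RAM.encVec_injective.comp Subtype.val_injective

/-- Min unsatisfy: given `⟨A, y⟩`, minimize `‖y - A x‖₀` over all rational `x`. -/
def MU : MinProblem where
  Inst := MUInst
  Sol I := Fin I.n → ℚ
  sol_nonempty _ := ⟨0⟩
  metric I x := hammingNorm (I.y - I.A *ᵥ x)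
  encInst I := RAM.encSystem I.A I.y
  encInst_injective := by
    rintro ⟨m, n, A, y⟩ ⟨m', n', A', y'⟩ h
    obtain ⟨rfl, rfl⟩ := RAM.encSystem_dims h
    obtain ⟨rfl, rfl⟩ := RAM.encSystem_inj h
    rfl
  encSol _ x := RAM.encVec x
  encSol_injective _ := RAM.encVec_injective

/-- `N` is a full null matrix for `A`: the columns of `N` are in the null space of `A`, and the rank
of `N` is the corank `n - rank A` of `A`. -/
def IsFullNullMatrix {m n k : ℕ} (A : Matrix (Fin m) (Fin n) ℚ) (N : Matrix (Fin n) (Fin k) ℚ) :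
    Prop :=
  A * N = 0 ∧ A.rank + N.rank = n

/-!
The orthogonal projection onto the null space of `D` is a canonical full null matrix for `D`, and
the last column of the orthogonal projection onto the null space of the augmented matrix `(D | s)`
is a multiple of `(-v, 1)` for a particular solution `v` of `D v = s`; so the reductions are
functions of the instance. They preserve `‖·‖₀` because, for a full null matrix `A` for `D`, the
vectors `y - A x` are exactly the solutions of `D v = D y`.

The projections are computed by intersecting with the null space of one row after another. Every
intermediate projection has a Gram determinant of rows as a common denominator, and dividing by the
previous one is exact. The entries of a projection have absolute value at most `1`, so the
numerators are at most the denominator, and each row multiplies the latter by a bounded factor;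
hence all bit lengths are polynomial.
-/

section OrthProj

variable {R ι κ : Type*} [CommRing R] [Fintype κ]

/-- `P` is the matrix of the orthogonal projection onto `V`, with respect to the standard dot
product: a symmetric matrix with range in `V` that fixes `V`. -/
structure IsOrthProj (V : Submodule R (κ → R)) (P : Matrix κ κ R) : Prop where
  symm : Pᵀ = P
  mem : ∀ z, P *ᵥ z ∈ V
  fix : ∀ z ∈ V, P *ᵥ z = z

/-- The null space of a matrix. -/
abbrev nullSpace (A : Matrix ι κ R) : Submodule R (κ → R) :=
  LinearMap.ker A.mulVecLin

theorem mem_nullSpace {A : Matrix ι κ R} {z : κ → R} :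
    z ∈ nullSpace A ↔ A *ᵥ z = 0 := Iff.rfl

theorem mem_nullSpace_replicateRow {a z : κ → R} :
    z ∈ nullSpace (replicateRow Unit a) ↔ a ⬝ᵥ z = 0 := by
  rw [mem_nullSpace, funext_iff]
  exact ⟨fun h => h (), fun h _ => h⟩

theorem nullSpace_fromRows {ι' : Type*} (A : Matrix ι κ R)
    (B : Matrix ι' κ R) : nullSpace (fromRows A B) = nullSpace A ⊓ nullSpace B := by
  ext z
  simp only [Submodule.mem_inf, mem_nullSpace, funext_iff, Sum.forall]
  rfl

theorem finrank_nullSpace {F : Type*} [Field F] (A : Matrix ι κ F) :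
    A.rank + Module.finrank F (nullSpace A) = Fintype.card κ := by
  rw [Matrix.rank, LinearMap.finrank_range_add_finrank_ker, Module.finrank_fintype_fun_eq_card]

namespace IsOrthProj

variable {V V' : Submodule R (κ → R)} {P P' : Matrix κ κ R}

theorem mul_eq (h : IsOrthProj V P) (h' : IsOrthProj V' P') (hV : V' ≤ V) : P * P' = P' := by
  classical
  refine Matrix.ext_of_mulVec_single fun i => ?_
  rw [← Matrix.mulVec_mulVec]
  exact h.fix _ (hV (h'.mem _))

theorem unique (h : IsOrthProj V P) (h' : IsOrthProj V P') : P = P' := by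
  have h_transpose := congrArg Matrix.transpose (h'.mul_eq h le_rfl)
  rw [Matrix.transpose_mul, h.symm, h'.symm, h.mul_eq h' le_rfl] at h_transpose
  exact h_transpose.symm

theorem mul_self (h : IsOrthProj V P) : P * P = P := h.mul_eq h le_rfl

theorem dotProduct_mulVec_comm (h : IsOrthProj V P) (a b : κ → R) :
    a ⬝ᵥ P *ᵥ b = P *ᵥ a ⬝ᵥ b := by
  rw [Matrix.dotProduct_mulVec, ← Matrix.mulVec_transpose, h.symm]

theorem dotProduct_mulVec_self (h : IsOrthProj V P) (a : κ → R) :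
    a ⬝ᵥ P *ᵥ a = P *ᵥ a ⬝ᵥ P *ᵥ a := by
  rw [← h.dotProduct_mulVec_comm, Matrix.mulVec_mulVec, h.mul_self]

theorem apply_self (h : IsOrthProj V P) (i : κ) : P i i = ∑ j, P i j ^ 2 := by
  conv_lhs => rw [← h.mul_self]
  rw [Matrix.mul_apply]
  refine Finset.sum_congr rfl fun j _ => ?_
  rw [sq, ← congrFun₂ h.symm i j, Matrix.transpose_apply]

theorem rank_eq (h : IsOrthProj V P) : P.rank = Module.finrank R V := by
  rw [Matrix.rank, show LinearMap.range P.mulVecLin = V from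
    le_antisymm (by rintro _ ⟨y, rfl⟩; exact h.mem y) fun z hz => ⟨z, h.fix z hz⟩]

theorem inf {K : Type*} [Field K] {V : Submodule K (κ → K)} {P : Matrix κ κ K}
    (h : IsOrthProj V P) {a : κ → K} (ha : a ⬝ᵥ P *ᵥ a ≠ 0) :
    IsOrthProj (V ⊓ nullSpace (replicateRow Unit a))
      (P - (a ⬝ᵥ P *ᵥ a)⁻¹ • vecMulVec (P *ᵥ a) (P *ᵥ a)) where
  symm := by
    rw [Matrix.transpose_sub, Matrix.transpose_smul, Matrix.transpose_vecMulVec, h.symm]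
  mem z := by
    rw [Submodule.mem_inf, mem_nullSpace_replicateRow, Matrix.sub_mulVec, Matrix.smul_mulVec,
      Matrix.vecMulVec_mulVec, op_smul_eq_smul]
    refine ⟨V.sub_mem (h.mem z) (V.smul_mem _ (V.smul_mem _ (h.mem a))), ?_⟩
    rw [dotProduct_sub, dotProduct_smul, dotProduct_smul, h.dotProduct_mulVec_comm a z,
      smul_eq_mul, smul_eq_mul, mul_left_comm, inv_mul_cancel₀ ha, mul_one, sub_self]
  fix z hz := by
    obtain ⟨hz, haz⟩ := Submodule.mem_inf.1 hz
    rw [mem_nullSpace_replicateRow] at haz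
    rw [Matrix.sub_mulVec, Matrix.smul_mulVec, Matrix.vecMulVec_mulVec,
      ← h.dotProduct_mulVec_comm, h.fix z hz, haz, MulOpposite.op_zero, zero_smul, smul_zero,
      sub_zero]

variable [LinearOrder R] [IsStrictOrderedRing R]

theorem sq_apply_le (h : IsOrthProj V P) (i j : κ) : P i j ^ 2 ≤ P i i := by
  rw [h.apply_self i]
  exact Finset.single_le_sum (f := fun j => P i j ^ 2) (fun _ _ => sq_nonneg _)
    (Finset.mem_univ j)

theorem abs_apply_le_one (h : IsOrthProj V P) (i j : κ) : |P i j| ≤ 1 := by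
  have h_diag : P i i ≤ 1 := by nlinarith [h.sq_apply_le i i]
  exact sq_le_one_iff_abs_le_one _ |>.1 ((h.sq_apply_le i j).trans h_diag)

theorem inf_eq_of_dotProduct_eq_zero (h : IsOrthProj V P) {a : κ → R} (ha : a ⬝ᵥ P *ᵥ a = 0) :
    V ⊓ nullSpace (replicateRow Unit a) = V := by
  rw [inf_eq_left]
  intro z hz
  rw [h.dotProduct_mulVec_self, dotProduct_self_eq_zero] at ha
  rw [mem_nullSpace_replicateRow, ← h.fix z hz, h.dotProduct_mulVec_comm, ha, zero_dotProduct]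

end IsOrthProj

theorem isOrthProj_top_one [DecidableEq κ] : IsOrthProj (⊤ : Submodule R (κ → R)) 1 where
  symm := Matrix.transpose_one
  mem _ := Submodule.mem_top
  fix z _ := Matrix.one_mulVec z

variable {K : Type*} [Field K] [LinearOrder K] [IsStrictOrderedRing K]

theorem exists_isOrthProj_nullSpace [Finite ι] (A : Matrix ι κ K) :
    ∃ P, IsOrthProj (nullSpace A) P := by
  classical
  have := Fintype.ofFinite ι
  have h_rows : ∀ t : Finset ι,
      ∃ P, IsOrthProj (⨅ i ∈ t, nullSpace (replicateRow Unit (A i))) P := by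
    intro t
    induction t using Finset.induction_on with
    | empty => exact ⟨1, by simpa using isOrthProj_top_one⟩
    | insert i t _ ih =>
      obtain ⟨P, hP⟩ := ih
      rw [Finset.iInf_insert, inf_comm]
      by_cases hi : A i ⬝ᵥ P *ᵥ A i = 0
      · exact ⟨P, by rwa [hP.inf_eq_of_dotProduct_eq_zero hi]⟩
      · exact ⟨_, hP.inf hi⟩
  convert h_rows Finset.univ
  ext z
  simp only [Finset.mem_univ, iInf_pos, Submodule.mem_iInf, mem_nullSpace_replicateRow]
  exact funext_iff

section NullProj

variable [Finite ι] (A : Matrix ι κ K)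

/-- The orthogonal projection onto the null space of `A`: a full null matrix for `A` which is
determined by `A`. -/
noncomputable def nullProj : Matrix κ κ K := (exists_isOrthProj_nullSpace A).choose

theorem isOrthProj_nullProj : IsOrthProj (nullSpace A) (nullProj A) :=
  (exists_isOrthProj_nullSpace A).choose_spec

theorem nullProj_smul {l : K} (hl : l ≠ 0) : nullProj (l • A) = nullProj A := by
  refine IsOrthProj.unique (V := nullSpace A) ?_ (isOrthProj_nullProj A)
  convert isOrthProj_nullProj (l • A) using 1
  ext z
  rw [mem_nullSpace, mem_nullSpace, Matrix.smul_mulVec, smul_eq_zero_iff_right hl]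

theorem mul_nullProj : A * nullProj A = 0 := by
  classical
  refine Matrix.ext_of_mulVec_single fun i => ?_
  rw [← Matrix.mulVec_mulVec, Matrix.zero_mulVec]
  exact (isOrthProj_nullProj A).mem _

theorem rank_add_rank_nullProj : A.rank + (nullProj A).rank = Fintype.card κ := by
  rw [(isOrthProj_nullProj A).rank_eq, finrank_nullSpace]

end NullProj

/-! ## Particular solutions -/

variable {n : ℕ}

/-- The matrix `D` with the additional column `s`. -/
def augment (D : Matrix ι (Fin n) R) (s : ι → R) : Matrix ι (Fin (n + 1)) R :=
  of fun i => Fin.snoc (D i) (s i)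

theorem augment_mulVec (D : Matrix ι (Fin n) R) (s : ι → R)
    (z : Fin (n + 1) → R) :
    augment D s *ᵥ z = D *ᵥ (fun j => z j.castSucc) + z (Fin.last n) • s := by
  ext i
  simp [augment, Matrix.mulVec, dotProduct, Fin.sum_univ_castSucc, mul_comm]

theorem snoc_zero_mem_nullSpace_augment {D : Matrix ι (Fin n) R} {s : ι → R}
    {z : Fin n → R} :
    (Fin.snoc z 0 : Fin (n + 1) → R) ∈ nullSpace (augment D s) ↔ z ∈ nullSpace D := by
  rw [mem_nullSpace, mem_nullSpace, augment_mulVec]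
  simp

variable [Finite ι]

/-- A particular solution of `D v = s`, if there is any: the last column of the projection onto the
null space of `[D | s]`, normalized so that its last entry is `-1`. -/
noncomputable def particular (D : Matrix ι (Fin n) K) (s : ι → K) (j : Fin n) : K :=
  -(nullProj (augment D s) j.castSucc (Fin.last n) /
    nullProj (augment D s) (Fin.last n) (Fin.last n))

variable {D : Matrix ι (Fin n) K} {s : ι → K}

theorem nullProj_augment_last_pos (h : ∃ v, D *ᵥ v = s) :
    0 < nullProj (augment D s) (Fin.last n) (Fin.last n) := by
  obtain ⟨v, hv⟩ := h
  have hP := isOrthProj_nullProj (augment D s)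
  have hz : (Fin.snoc v (-1) : Fin (n + 1) → K) ∈ nullSpace (augment D s) := by
    rw [mem_nullSpace, augment_mulVec]
    simp [hv]
  refine (hP.sq_apply_le (Fin.last n) (Fin.last n)).trans' (sq_nonneg _) |>.lt_of_ne fun h0 => ?_
  have h_row : ∀ j, nullProj (augment D s) (Fin.last n) j = 0 := fun j =>
    pow_eq_zero_iff two_ne_zero |>.1
      ((hP.sq_apply_le (Fin.last n) j).trans h0.ge |>.antisymm (sq_nonneg _))
  have h_fix := congrFun (hP.fix _ hz) (Fin.last n)
  simp [Matrix.mulVec, dotProduct, h_row] at h_fix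

theorem mulVec_particular (h : ∃ v, D *ᵥ v = s) : D *ᵥ particular D s = s := by
  set P := nullProj (augment D s) with hP_def
  have h0 : P (Fin.last n) (Fin.last n) ≠ 0 := (nullProj_augment_last_pos h).ne'
  have h_col := (isOrthProj_nullProj (augment D s)).mem (Pi.single (Fin.last n) 1)
  rw [mem_nullSpace, augment_mulVec, Matrix.mulVec_single_one] at h_col
  have h_particular : particular D s =
      -(P (Fin.last n) (Fin.last n))⁻¹ • fun j : Fin n => P j.castSucc (Fin.last n) := by
    ext j
    simp only [particular, Pi.smul_apply, smul_eq_mul, ← hP_def]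
    field_simp
  rw [h_particular, Matrix.mulVec_smul,
    show D *ᵥ (fun j : Fin n => P j.castSucc (Fin.last n)) = -(P (Fin.last n) (Fin.last n) • s)
      from eq_neg_of_add_eq_zero_left h_col,
    smul_neg, neg_smul, neg_neg, smul_smul, inv_mul_cancel₀ h0, one_smul]

/-- A Schur complement, since the null space of `D` is cut out of that of `[D | s]` by one
coordinate hyperplane. -/
theorem nullProj_eq_nullProj_augment
    (h0 : nullProj (augment D s) (Fin.last n) (Fin.last n) ≠ 0) (i j : Fin n) :
    nullProj D i j = nullProj (augment D s) i.castSucc j.castSucc -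
      nullProj (augment D s) i.castSucc (Fin.last n) *
        nullProj (augment D s) j.castSucc (Fin.last n) /
          nullProj (augment D s) (Fin.last n) (Fin.last n) := by
  set P := nullProj (augment D s)
  have hP : IsOrthProj (nullSpace (augment D s)) P := isOrthProj_nullProj _
  set Q := P - (P (Fin.last n) (Fin.last n))⁻¹ • vecMulVec (P.col (Fin.last n)) (P.col (Fin.last n))
    with hQ_def
  have hQ : IsOrthProj (nullSpace (augment D s) ⊓
      nullSpace (replicateRow Unit (Pi.single (Fin.last n) 1))) Q := by
    simpa only [Matrix.mulVec_single_one, single_one_dotProduct, Matrix.col_apply] using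
      hP.inf (a := Pi.single (Fin.last n) 1) (by simpa using h0)
  have h_mulVec : ∀ z : Fin n → K, Fin.snoc (Q.submatrix Fin.castSucc Fin.castSucc *ᵥ z) 0 =
      Q *ᵥ (Fin.snoc z 0 : Fin (n + 1) → K) := by
    intro z
    have h_last := (hQ.mem (Fin.snoc z 0)).2
    rw [SetLike.mem_coe, mem_nullSpace_replicateRow, single_one_dotProduct] at h_last
    refine funext fun i => Fin.lastCases ?_ (fun i => ?_) i
    · rw [h_last, Fin.snoc_last]
    · simp [Matrix.mulVec, dotProduct, Fin.sum_univ_castSucc]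
  have hD : IsOrthProj (nullSpace D) (Q.submatrix Fin.castSucc Fin.castSucc) :=
    { symm := by rw [Matrix.transpose_submatrix, hQ.symm]
      mem := fun z => by
        rw [← snoc_zero_mem_nullSpace_augment (s := s), h_mulVec]
        exact (hQ.mem _).1
      fix := fun z hz => by
        refine Fin.snoc_left_injective (α := fun _ => K) (0 : K)
          ((h_mulVec z).trans (hQ.fix _ ⟨?_, ?_⟩))
        · exact snoc_zero_mem_nullSpace_augment.2 hz
        · rw [SetLike.mem_coe, mem_nullSpace_replicateRow, single_one_dotProduct, Fin.snoc_last] }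
  rw [(isOrthProj_nullProj D).unique hD, Matrix.submatrix_apply, hQ_def, Matrix.sub_apply,
    Matrix.smul_apply, Matrix.vecMulVec_apply, Matrix.col_apply, Matrix.col_apply, smul_eq_mul,
    inv_mul_eq_div]

theorem nullProj_mulVec_eq
    (h0 : nullProj (augment D s) (Fin.last n) (Fin.last n) ≠ 0) (x : Fin n → K) (i : Fin n) :
    (nullProj D *ᵥ x) i =
      (nullProj (augment D s) *ᵥ (Fin.snoc x 0 : Fin (n + 1) → K)) i.castSucc -
        nullProj (augment D s) i.castSucc (Fin.last n) *
          (nullProj (augment D s) *ᵥ (Fin.snoc x 0 : Fin (n + 1) → K)) (Fin.last n) /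
            nullProj (augment D s) (Fin.last n) (Fin.last n) := by
  have h_symm (j : Fin n) : nullProj (augment D s) (Fin.last n) j.castSucc =
      nullProj (augment D s) j.castSucc (Fin.last n) :=
    (congrFun₂ (isOrthProj_nullProj (augment D s)).symm (Fin.last n) j.castSucc).symm
  simp only [Matrix.mulVec, dotProduct, nullProj_eq_nullProj_augment h0, Fin.sum_univ_castSucc,
    Fin.snoc_castSucc, Fin.snoc_last, mul_zero, add_zero, h_symm, Finset.mul_sum, Finset.sum_div,
    ← Finset.sum_sub_distrib]
  exact Finset.sum_congr rfl fun j _ => by ring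

end OrthProj

/-! ## Gram determinants as denominators -/

section Gram

variable {R ι κ : Type*} [CommRing R] [Fintype ι] [DecidableEq ι] [Fintype κ] [DecidableEq κ]

/-- The projection onto the null space of `S`, multiplied by the Gram determinant of the rows
of `S`, so that no division is left. -/
def gramProj (S : Matrix ι κ R) : Matrix κ κ R :=
  (S * Sᵀ).det • 1 - Sᵀ * (S * Sᵀ).adjugate * S

theorem gramProj_map {R' : Type*} [CommRing R'] (f : R →+* R') (S : Matrix ι κ R) :
    gramProj (S.map f) = (gramProj S).map f := by
  have h_gram : S.map f * (S.map f)ᵀ = f.mapMatrix (S * Sᵀ) := by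
    rw [RingHom.mapMatrix_apply, Matrix.map_mul, Matrix.transpose_map]
  rw [gramProj, gramProj, h_gram, ← RingHom.map_adjugate, ← RingHom.map_det,
    Matrix.map_sub _ f.map_sub, Matrix.map_mul, Matrix.map_mul, RingHom.mapMatrix_apply,
    Matrix.transpose_map, Matrix.map_smul' _ _ _ f.map_mul, Matrix.map_one _ f.map_zero f.map_one]

variable {K : Type*} [Field K] {S : Matrix ι κ K}

theorem gramProj_eq_det_smul (hS : (S * Sᵀ).det ≠ 0) :
    gramProj S = (S * Sᵀ).det • (1 - Sᵀ * (S * Sᵀ)⁻¹ * S) := by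
  rw [gramProj, Matrix.inv_def, Ring.inverse_eq_inv', smul_sub, Matrix.mul_smul, Matrix.smul_mul,
    smul_smul, mul_inv_cancel₀ hS, one_smul]

theorem isOrthProj_gramProj (hS : (S * Sᵀ).det ≠ 0) :
    IsOrthProj (nullSpace S) ((S * Sᵀ).det⁻¹ • gramProj S) := by
  rw [gramProj_eq_det_smul hS, smul_smul, inv_mul_cancel₀ hS, one_smul]
  refine ⟨?_, fun z => ?_, fun z hz => ?_⟩
  · simp only [Matrix.transpose_sub, Matrix.transpose_one, Matrix.transpose_mul,
      Matrix.transpose_nonsing_inv, Matrix.transpose_transpose, Matrix.mul_assoc]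
  · rw [mem_nullSpace, Matrix.mulVec_mulVec, Matrix.mul_sub, Matrix.mul_one, ← Matrix.mul_assoc,
      ← Matrix.mul_assoc, Matrix.mul_nonsing_inv _ hS.isUnit, Matrix.one_mul, sub_self,
      Matrix.zero_mulVec]
  · rw [mem_nullSpace] at hz
    rw [Matrix.sub_mulVec, ← Matrix.mulVec_mulVec, hz, Matrix.mulVec_zero, Matrix.one_mulVec,
      sub_zero]

theorem det_gram_fromRows (hS : (S * Sᵀ).det ≠ 0) (a : κ → K) :
    (fromRows S (replicateRow Unit a) * (fromRows S (replicateRow Unit a))ᵀ).det =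
      a ⬝ᵥ gramProj S *ᵥ a := by
  have : Invertible (S * Sᵀ) := Matrix.invertibleOfIsUnitDet _ hS.isUnit
  have h_schur : replicateRow Unit a * (replicateRow Unit a)ᵀ -
      replicateRow Unit a * Sᵀ * (S * Sᵀ)⁻¹ * (S * (replicateRow Unit a)ᵀ) =
      replicateRow Unit a * ((1 - Sᵀ * (S * Sᵀ)⁻¹ * S) * (replicateRow Unit a)ᵀ) := by
    simp only [Matrix.sub_mul, Matrix.mul_sub, Matrix.mul_assoc, Matrix.one_mul]
  rw [Matrix.transpose_fromRows, Matrix.fromRows_mul_fromCols, Matrix.det_fromBlocks₁₁,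
    Matrix.det_unique (n := Unit), Matrix.invOf_eq_nonsing_inv, h_schur,
    gramProj_eq_det_smul hS, Matrix.smul_mulVec, dotProduct_smul, smul_eq_mul]
  rfl

theorem gramProj_fromRows (hS : (S * Sᵀ).det ≠ 0) {a : κ → K}
    (ha : a ⬝ᵥ gramProj S *ᵥ a ≠ 0) :
    (S * Sᵀ).det • gramProj (fromRows S (replicateRow Unit a)) =
      (a ⬝ᵥ gramProj S *ᵥ a) • gramProj S -
        vecMulVec (gramProj S *ᵥ a) (gramProj S *ᵥ a) := by
  set S' := fromRows S (replicateRow Unit a)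
  set G := gramProj S with hG
  have h_det : (S' * S'ᵀ).det = a ⬝ᵥ G *ᵥ a := det_gram_fromRows hS a
  have h_dot : a ⬝ᵥ ((S * Sᵀ).det⁻¹ • G) *ᵥ a = (S * Sᵀ).det⁻¹ * (a ⬝ᵥ G *ᵥ a) := by
    rw [Matrix.smul_mulVec, dotProduct_smul, smul_eq_mul]
  have h_inf := (isOrthProj_gramProj hS).inf (a := a)
    (by rw [h_dot]; exact mul_ne_zero (inv_ne_zero hS) ha)
  rw [← nullSpace_fromRows, ← hG] at h_inf
  have h_eq := (isOrthProj_gramProj (S := S') (by rwa [h_det])).unique h_inf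
  rw [h_det, h_dot, Matrix.smul_mulVec, inv_smul_eq_iff₀ ha] at h_eq
  rw [h_eq]
  ext i j
  simp only [Matrix.smul_apply, Matrix.sub_apply, Matrix.vecMulVec_apply, Pi.smul_apply,
    smul_eq_mul]
  field_simp

end Gram

section IntGram

/-- An integer vector as a rational vector. -/
def ratVec {κ : Type*} (a : κ → ℤ) : κ → ℚ := fun i => a i

/-- An integer matrix as a rational matrix. -/
def ratMat {ι κ : Type*} (S : Matrix ι κ ℤ) : Matrix ι κ ℚ := S.map (Int.castRingHom ℚ)

theorem ratMat_apply {ι κ : Type*} (S : Matrix ι κ ℤ) (i : ι) (j : κ) : ratMat S i j = S i j := rfl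

variable {ι κ : Type*} [Fintype κ]

theorem ratMat_mulVec (A : Matrix ι κ ℤ) (a : κ → ℤ) : ratMat A *ᵥ ratVec a = ratVec (A *ᵥ a) :=
  funext fun i => (RingHom.map_mulVec (Int.castRingHom ℚ) A a i).symm

theorem ratVec_dotProduct (a b : κ → ℤ) : ratVec a ⬝ᵥ ratVec b = ((a ⬝ᵥ b : ℤ) : ℚ) :=
  (RingHom.map_dotProduct (Int.castRingHom ℚ) a b).symm

theorem det_gram_ratMat [Fintype ι] [DecidableEq ι] (S : Matrix ι κ ℤ) :
    (ratMat S * (ratMat S)ᵀ).det = (S * Sᵀ).det := by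
  rw [ratMat, ← Matrix.transpose_map, ← Matrix.map_mul, ← RingHom.mapMatrix_apply,
    ← RingHom.map_det, eq_intCast]

variable [DecidableEq κ] {V : Submodule ℚ (κ → ℚ)} {Z : Matrix κ κ ℤ} {d : ℤ}

theorem gramProj_ratMat [Fintype ι] [DecidableEq ι] (S : Matrix ι κ ℤ) :
    gramProj (ratMat S) = ratMat (gramProj S) :=
  gramProj_map _ S

/-- `Z` and `d` are the numerators and the common denominator of the projection onto `V` that come
from independent integer vectors spanning the orthogonal complement of `V`. -/
def IsIntGramProj (V : Submodule ℚ (κ → ℚ)) (Z : Matrix κ κ ℤ) (d : ℤ) : Prop :=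
  0 < d ∧ ∃ (ι : Type) (_ : Fintype ι) (_ : DecidableEq ι) (S : Matrix ι κ ℤ),
    Z = gramProj S ∧ d = (S * Sᵀ).det ∧ V = nullSpace (ratMat S)

theorem isIntGramProj_top_one : IsIntGramProj (⊤ : Submodule ℚ (κ → ℚ)) 1 1 := by
  refine ⟨one_pos, Empty, inferInstance, inferInstance, 0, ?_, ?_, ?_⟩
  · simp [gramProj]
  · simp
  · ext z
    simp [Subsingleton.elim _ (0 : Empty → ℚ)]

namespace IsIntGramProj

theorem isOrthProj (h : IsIntGramProj V Z d) : IsOrthProj V ((d : ℚ)⁻¹ • ratMat Z) := by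
  obtain ⟨hd, ι, _, _, S, rfl, rfl, rfl⟩ := h
  rw [← gramProj_ratMat, ← det_gram_ratMat]
  exact isOrthProj_gramProj (by rw [det_gram_ratMat]; exact_mod_cast hd.ne')

theorem abs_apply_le (h : IsIntGramProj V Z d) (i j : κ) : |Z i j| ≤ d := by
  have hd : (0 : ℚ) < d := by exact_mod_cast h.1
  have h_abs := h.isOrthProj.abs_apply_le_one i j
  rw [Matrix.smul_apply, ratMat_apply, smul_eq_mul, abs_mul, abs_inv,
    abs_of_pos hd, inv_mul_le_one₀ hd] at h_abs
  exact_mod_cast h_abs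

theorem eq_smul_nullProj [Finite ι] {A : Matrix ι κ ℚ}
    (h : IsIntGramProj (nullSpace A) Z d) : ratMat Z = (d : ℚ) • nullProj A := by
  have hd : (d : ℚ) ≠ 0 := by exact_mod_cast h.1.ne'
  rw [(isOrthProj_nullProj A).unique h.isOrthProj, smul_inv_smul₀ hd]

theorem dotProduct_mulVec_nonneg (h : IsIntGramProj V Z d) (a : κ → ℤ) : 0 ≤ a ⬝ᵥ Z *ᵥ a := by
  have h_sq := h.isOrthProj.dotProduct_mulVec_self (ratVec a)
  have h_nonneg : 0 ≤ (d : ℚ)⁻¹ * ((a ⬝ᵥ Z *ᵥ a : ℤ) : ℚ) := by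
    rw [← ratVec_dotProduct, ← ratMat_mulVec, ← smul_eq_mul, ← dotProduct_smul,
      ← Matrix.smul_mulVec, h_sq]
    exact Finset.sum_nonneg fun i _ => mul_self_nonneg _
  exact_mod_cast nonneg_of_mul_nonneg_right h_nonneg (inv_pos.2 (by exact_mod_cast h.1))

theorem inf_of_dotProduct_eq_zero (h : IsIntGramProj V Z d) {a : κ → ℤ} (ha : a ⬝ᵥ Z *ᵥ a = 0) :
    IsIntGramProj (V ⊓ nullSpace (replicateRow Unit (ratVec a))) Z d := by
  rwa [h.isOrthProj.inf_eq_of_dotProduct_eq_zero]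
  rw [Matrix.smul_mulVec, dotProduct_smul, ratMat_mulVec, ratVec_dotProduct, ha, Int.cast_zero,
    smul_zero]

/-- One step of fraction-free elimination: the division by `d` is exact, since both `Z` and the
result are polynomials in the entries of integer matrices. -/
theorem inf (h : IsIntGramProj V Z d) {a : κ → ℤ} (ha : 0 < a ⬝ᵥ Z *ᵥ a) :
    IsIntGramProj (V ⊓ nullSpace (replicateRow Unit (ratVec a)))
      (of fun i j => ((a ⬝ᵥ Z *ᵥ a) * Z i j - (Z *ᵥ a) i * (Z *ᵥ a) j) / d) (a ⬝ᵥ Z *ᵥ a) := by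
  obtain ⟨hd, ι, _, _, S, rfl, rfl, rfl⟩ := h
  have h_map : ratMat (fromRows S (replicateRow Unit a)) =
      fromRows (ratMat S) (replicateRow Unit (ratVec a)) := by
    ext i j
    cases i <;> rfl
  have hS : (ratMat S * (ratMat S)ᵀ).det ≠ 0 := by
    rw [det_gram_ratMat]
    exact_mod_cast hd.ne'
  have h_dot : ratVec a ⬝ᵥ gramProj (ratMat S) *ᵥ ratVec a = ((a ⬝ᵥ gramProj S *ᵥ a : ℤ) : ℚ) := by
    rw [gramProj_ratMat, ratMat_mulVec, ratVec_dotProduct]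
  refine ⟨ha, ι ⊕ Unit, inferInstance, inferInstance, fromRows S (replicateRow Unit a), ?_, ?_, ?_⟩
  · have h_eq := gramProj_fromRows hS (a := ratVec a) (by rw [h_dot]; exact_mod_cast ha.ne')
    rw [← h_map, h_dot, gramProj_ratMat, gramProj_ratMat, ratMat_mulVec, det_gram_ratMat] at h_eq
    ext i j
    have h_apply := congrFun₂ h_eq i j
    simp only [Matrix.smul_apply, Matrix.sub_apply, ratMat_apply, Matrix.vecMulVec_apply,
      ratVec, smul_eq_mul] at h_apply
    refine Int.ediv_eq_of_eq_mul_right hd.ne' ?_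
    exact_mod_cast h_apply.symm
  · have h_det := det_gram_fromRows hS (ratVec a)
    rw [← h_map, h_dot, det_gram_ratMat] at h_det
    exact_mod_cast h_det.symm
  · rw [h_map, nullSpace_fromRows]

end IsIntGramProj

end IntGram

/-! ## Fraction-free elimination -/

/-- The dot product of the first `c` entries. -/
def dotN (c : ℕ) (a b : ℕ → ℤ) : ℤ := ∑ i ∈ Finset.range c, a i * b i

theorem dotN_succ (c : ℕ) (a b : ℕ → ℤ) : dotN (c + 1) a b = dotN c a b + a c * b c :=
  Finset.sum_range_succ _ _

theorem dotN_eq_dotProduct (c : ℕ) (a b : ℕ → ℤ) :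
    dotN c a b = (fun i : Fin c => a i) ⬝ᵥ fun i : Fin c => b i :=
  Finset.sum_range _

theorem natAbs_dotN_le {c D E : ℕ} {a b : ℕ → ℤ} (ha : ∀ i < c, (a i).natAbs ≤ D)
    (hb : ∀ i < c, (b i).natAbs ≤ E) : (dotN c a b).natAbs ≤ c * (D * E) := by
  calc (dotN c a b).natAbs ≤ ∑ i ∈ Finset.range c, (a i * b i).natAbs := Int.natAbs_sum_le _ _
    _ ≤ ∑ _i ∈ Finset.range c, D * E := Finset.sum_le_sum fun i hi => by
        rw [Int.natAbs_mul]
        exact Nat.mul_le_mul (ha i (Finset.mem_range.1 hi)) (hb i (Finset.mem_range.1 hi))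
    _ = c * (D * E) := by rw [Finset.sum_const, Finset.card_range, smul_eq_mul]

/-- A square matrix of rationals with a common denominator. The indices range over `ℕ`, as they do
for the arrays of a random access machine; the dimension is passed separately. -/
structure FracMatrix where
  num : ℕ → ℕ → ℤ
  den : ℤ

namespace FracMatrix

/-- The product of the numerators with a vector. -/
def numMulVec (F : FracMatrix) (c : ℕ) (a : ℕ → ℤ) (i : ℕ) : ℤ := dotN c (F.num i) a

/-- The numerators in dimension `c`. -/
def toMatrix (F : FracMatrix) (c : ℕ) : Matrix (Fin c) (Fin c) ℤ := of fun i j => F.num i j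

theorem numMulVec_eq (F : FracMatrix) (c : ℕ) (a : ℕ → ℤ) (i : Fin c) :
    F.numMulVec c a i = (F.toMatrix c *ᵥ fun j => a j) i :=
  dotN_eq_dotProduct c _ _

/-- Restricts the range of a projection to the vectors orthogonal to `a`. -/
def elimStep (F : FracMatrix) (c : ℕ) (a : ℕ → ℤ) : FracMatrix :=
  if 0 < dotN c a (F.numMulVec c a) then
    { num := fun i j => (dotN c a (F.numMulVec c a) * F.num i j -
        F.numMulVec c a i * F.numMulVec c a j) / F.den
      den := dotN c a (F.numMulVec c a) }
  else F

theorem elimStep_of_pos {F : FracMatrix} {c : ℕ} {a : ℕ → ℤ}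
    (h : 0 < dotN c a (F.numMulVec c a)) : F.elimStep c a =
      { num := fun i j => (dotN c a (F.numMulVec c a) * F.num i j -
          F.numMulVec c a i * F.numMulVec c a j) / F.den
        den := dotN c a (F.numMulVec c a) } :=
  if_pos h

theorem elimStep_of_not_pos {F : FracMatrix} {c : ℕ} {a : ℕ → ℤ}
    (h : ¬ 0 < dotN c a (F.numMulVec c a)) : F.elimStep c a = F :=
  if_neg h

/-- The projection onto the vectors orthogonal to the first `k` rows of `R`, computed by
fraction-free elimination. -/
def elim (c : ℕ) (R : ℕ → ℕ → ℤ) : ℕ → FracMatrix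
  | 0 => ⟨fun i j => if i = j then 1 else 0, 1⟩
  | k + 1 => (elim c R k).elimStep c (R k)

end FracMatrix

/-- The matrix of the first `k` rows and `c` columns of `R`. -/
def rowMat (c : ℕ) (R : ℕ → ℕ → ℤ) (k : ℕ) : Matrix (Fin k) (Fin c) ℚ := of fun i j => (R i j : ℚ)

theorem nullSpace_rowMat_succ (c : ℕ) (R : ℕ → ℕ → ℤ) (k : ℕ) : nullSpace (rowMat c R (k + 1)) =
    nullSpace (rowMat c R k) ⊓ nullSpace (replicateRow Unit (ratVec fun j : Fin c => R k j)) := by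
  ext z
  rw [Submodule.mem_inf, mem_nullSpace_replicateRow, mem_nullSpace, mem_nullSpace, funext_iff,
    funext_iff, Fin.forall_fin_succ']
  rfl

theorem IsIntGramProj.elimStep {c : ℕ} {V : Submodule ℚ (Fin c → ℚ)} {F : FracMatrix}
    (h : IsIntGramProj V (F.toMatrix c) F.den) (a : ℕ → ℤ) :
    IsIntGramProj (V ⊓ nullSpace (replicateRow Unit (ratVec fun j : Fin c => a j)))
      ((F.elimStep c a).toMatrix c) (F.elimStep c a).den := by
  have h_dot : dotN c a (F.numMulVec c a) =
      (fun j : Fin c => a j) ⬝ᵥ F.toMatrix c *ᵥ fun j : Fin c => a j := by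
    rw [dotN_eq_dotProduct]
    congr 1
    exact funext fun i => F.numMulVec_eq c a i
  by_cases h_pos : 0 < dotN c a (F.numMulVec c a)
  · convert h.inf (h_dot ▸ h_pos) using 1
    · ext i j
      simp only [FracMatrix.elimStep_of_pos h_pos, FracMatrix.toMatrix, of_apply,
        F.numMulVec_eq, h_dot]
    · rw [FracMatrix.elimStep_of_pos h_pos, h_dot]
  · rw [FracMatrix.elimStep_of_not_pos h_pos]
    exact h.inf_of_dotProduct_eq_zero
      (h_dot ▸ le_antisymm (not_lt.1 h_pos) (h_dot ▸ h.dotProduct_mulVec_nonneg _))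

namespace FracMatrix

variable (c : ℕ) (R : ℕ → ℕ → ℤ)

theorem isIntGramProj_elim (k : ℕ) :
    IsIntGramProj (nullSpace (rowMat c R k)) ((elim c R k).toMatrix c) (elim c R k).den := by
  induction k with
  | zero =>
    have h_space : nullSpace (rowMat c R 0) = ⊤ :=
      eq_top_iff.2 fun _ _ => mem_nullSpace.2 (Subsingleton.elim _ _)
    have h_one : (elim c R 0).toMatrix c = 1 := by
      ext i j
      simp [elim, toMatrix, Matrix.one_apply, Fin.ext_iff]
    rw [h_space, h_one]
    exact isIntGramProj_top_one
  | succ k ih =>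
    rw [nullSpace_rowMat_succ]
    exact ih.elimStep (R k)

theorem elim_den_pos (k : ℕ) : 0 < (elim c R k).den := (isIntGramProj_elim c R k).1

variable {c R}

theorem natAbs_elim_num_le (k : ℕ) {i j : ℕ} (hi : i < c) (hj : j < c) :
    ((elim c R k).num i j).natAbs ≤ (elim c R k).den.natAbs := by
  have h_abs := (isIntGramProj_elim c R k).abs_apply_le ⟨i, hi⟩ ⟨j, hj⟩
  rw [← abs_of_pos (elim_den_pos c R k), Int.abs_eq_natAbs, Int.abs_eq_natAbs] at h_abs
  exact_mod_cast h_abs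

theorem elim_num_eq {r : ℕ} {A : Matrix (Fin r) (Fin c) ℚ} {l : ℚ} (hl : l ≠ 0)
    (hR : ∀ (i : Fin r) (j : Fin c), (R i j : ℚ) = l * A i j) (i j : Fin c) :
    ((elim c R r).num i j : ℚ) = (elim c R r).den * nullProj A i j := by
  have h_rows : rowMat c R r = l • A := by
    ext i j
    exact hR i j
  rw [← nullProj_smul A hl, ← h_rows]
  exact congrFun₂ (isIntGramProj_elim c R r).eq_smul_nullProj i j

theorem natAbs_numMulVec_le {F : FracMatrix} {D E : ℕ} {a : ℕ → ℤ} {i : ℕ}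
    (hF : ∀ j < c, (F.num i j).natAbs ≤ D) (ha : ∀ j < c, (a j).natAbs ≤ E) :
    (F.numMulVec c a i).natAbs ≤ c * (D * E) :=
  natAbs_dotN_le hF ha

theorem natAbs_elim_den_le {E N : ℕ} (hE : 1 ≤ E) (hR : ∀ i < N, ∀ j < c, (R i j).natAbs ≤ E)
    {k : ℕ} (hk : k ≤ N) : (elim c R k).den.natAbs ≤ ((c + 1) * E) ^ (2 * k) := by
  induction k with
  | zero => simp [elim]
  | succ k ih =>
    have h_one_le : 1 ≤ (c + 1) * E := Nat.mul_pos c.succ_pos hE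
    have h_den := ih (by omega)
    by_cases h_pos : 0 < dotN c (R k) ((elim c R k).numMulVec c (R k))
    · rw [elim, elimStep_of_pos h_pos]
      calc (dotN c (R k) ((elim c R k).numMulVec c (R k))).natAbs
          ≤ c * (E * (c * (((c + 1) * E) ^ (2 * k) * E))) :=
            natAbs_dotN_le (hR k (by omega)) fun i hi =>
              natAbs_numMulVec_le (fun j hj => (natAbs_elim_num_le k hi hj).trans h_den)
                (hR k (by omega))
        _ = (c * E) * (c * E) * ((c + 1) * E) ^ (2 * k) := by ring
        _ ≤ ((c + 1) * E) * ((c + 1) * E) * ((c + 1) * E) ^ (2 * k) := by gcongr <;> omega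
        _ = ((c + 1) * E) ^ (2 * (k + 1)) := by ring
    · rw [elim, elimStep_of_not_pos h_pos]
      exact h_den.trans (Nat.pow_le_pow_right h_one_le (by omega))

end FracMatrix

/-! ## The reductions -/

section FullNullMatrix

variable {m n k : ℕ} {A : Matrix (Fin m) (Fin n) ℚ}

theorem isFullNullMatrix_nullProj (A : Matrix (Fin m) (Fin n) ℚ) :
    IsFullNullMatrix A (nullProj A) :=
  ⟨mul_nullProj A, (rank_add_rank_nullProj A).trans (Fintype.card_fin n)⟩

theorem isFullNullMatrix_nullProj_transpose (A : Matrix (Fin m) (Fin n) ℚ) :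
    IsFullNullMatrix (nullProj Aᵀ) A := by
  refine ⟨?_, ?_⟩
  · have h_mul := congrArg Matrix.transpose (mul_nullProj Aᵀ)
    rwa [Matrix.transpose_mul, (isOrthProj_nullProj _).symm, Matrix.transpose_transpose,
      Matrix.transpose_zero] at h_mul
  · rw [add_comm, ← Matrix.rank_transpose A]
    exact (isFullNullMatrix_nullProj Aᵀ).2

theorem IsFullNullMatrix.exists_mulVec_eq {N : Matrix (Fin n) (Fin k) ℚ}
    (h : IsFullNullMatrix A N) {v : Fin n → ℚ} (hv : A *ᵥ v = 0) : ∃ x, N *ᵥ x = v := by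
  have h_le : LinearMap.range N.mulVecLin ≤ nullSpace A := by
    rintro _ ⟨x, rfl⟩
    rw [mem_nullSpace, Matrix.mulVecLin_apply, Matrix.mulVec_mulVec, h.1, Matrix.zero_mulVec]
  have h_finrank : Module.finrank ℚ (LinearMap.range N.mulVecLin) =
      Module.finrank ℚ (nullSpace A) := by
    have h_corank := finrank_nullSpace A
    rw [Fintype.card_fin] at h_corank
    exact add_left_cancel (h.2.trans h_corank.symm)
  exact (Submodule.eq_of_le_of_finrank_eq h_le h_finrank).ge hv

end FullNullMatrix

theorem MinProblem.opt_le_opt {F G : MinProblem} {x : F.Inst} {x' : G.Inst}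
    (h : ∀ y : F.Sol x, ∃ y' : G.Sol x', G.metric x' y' = F.metric x y) :
    G.opt x' ≤ F.opt x := by
  have := F.sol_nonempty x
  obtain ⟨y, hy⟩ := Nat.sInf_mem (Set.range_nonempty (F.metric x))
  obtain ⟨y', hy'⟩ := h y
  exact Nat.sInf_le ⟨y', hy'.trans hy⟩

namespace EDRInst

theorem exists_mulVec_eq (I : EDRInst) : ∃ v, I.D *ᵥ v = I.s := by
  have h_mem := I.mem
  rwa [← Matrix.range_mulVecLin] at h_mem

/-- The reduction from exact dictionary representation to min unsatisfy, on instances. -/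
noncomputable def toMU (I : EDRInst) : MUInst where
  m := I.n
  n := I.n
  A := nullProj I.D
  y := particular I.D I.s

/-- The reduction from exact dictionary representation to min unsatisfy, on solutions. -/
noncomputable def ofMUSol (I : EDRInst) (x : Fin I.n → ℚ) : {v : Fin I.n → ℚ // I.D *ᵥ v = I.s} :=
  ⟨particular I.D I.s - nullProj I.D *ᵥ x, by
    rw [Matrix.mulVec_sub, mulVec_particular I.exists_mulVec_eq, Matrix.mulVec_mulVec,
      mul_nullProj, Matrix.zero_mulVec, sub_zero]⟩

theorem isExactReduction
    (h₁ : RAM.PolyTime EDR.encInst fun I => MU.encInst (toMU I))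
    (h₂ : RAM.PolyTime
      (fun p : (I : EDRInst) × (Fin I.n → ℚ) => RAM.encPair (EDR.encInst p.1) (RAM.encVec p.2))
      fun p => RAM.encVec (p.1.ofMUSol p.2).1) :
    MinProblem.IsExactReduction EDR MU toMU ofMUSol where
  polyTime_fst := h₁
  polyTime_snd := h₂
  metric_eq _ _ := rfl
  opt_le I := MinProblem.opt_le_opt fun v => by
    obtain ⟨x, hx⟩ := (isFullNullMatrix_nullProj I.D).exists_mulVec_eq
      (v := particular I.D I.s - v.1)
      (by rw [Matrix.mulVec_sub, mulVec_particular I.exists_mulVec_eq, v.2, sub_self])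
    exact ⟨x, congrArg hammingNorm
      (show particular I.D I.s - nullProj I.D *ᵥ x = v.1 by rw [hx, sub_sub_cancel])⟩

end EDRInst

namespace MUInst

/-- The reduction from min unsatisfy to exact dictionary representation, on instances. -/
noncomputable def toEDR (I : MUInst) : EDRInst := EDRInst.ofVec (nullProj I.Aᵀ) I.y

variable (I : MUInst)
  (v : {v : Fin I.m → ℚ // nullProj I.Aᵀ *ᵥ v = nullProj I.Aᵀ *ᵥ I.y})

/-- The reduction from min unsatisfy to exact dictionary representation, on solutions. -/
noncomputable def ofEDRSol : Fin I.n → ℚ := particular I.A (I.y - v.1)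

theorem exists_mulVec_eq : ∃ x, I.A *ᵥ x = I.y - v.1 :=
  (isFullNullMatrix_nullProj_transpose I.A).exists_mulVec_eq
    (by rw [Matrix.mulVec_sub, v.2, sub_self])

theorem mulVec_ofEDRSol : I.A *ᵥ I.ofEDRSol v = I.y - v.1 :=
  mulVec_particular (I.exists_mulVec_eq v)

theorem sub_mulVec_ofEDRSol : I.y - I.A *ᵥ I.ofEDRSol v = v.1 := by
  rw [mulVec_ofEDRSol, sub_sub_cancel]

theorem nullProj_mulVec_sub (x : Fin I.n → ℚ) :
    nullProj I.Aᵀ *ᵥ (I.y - I.A *ᵥ x) = nullProj I.Aᵀ *ᵥ I.y := by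
  rw [Matrix.mulVec_sub, Matrix.mulVec_mulVec, (isFullNullMatrix_nullProj_transpose I.A).1,
    Matrix.zero_mulVec, sub_zero]

theorem isExactReduction
    (h₁ : RAM.PolyTime MU.encInst fun I => EDR.encInst (toEDR I))
    (h₂ : RAM.PolyTime
      (fun p : (I : MUInst) × {v : Fin I.m → ℚ // nullProj I.Aᵀ *ᵥ v = nullProj I.Aᵀ *ᵥ I.y} =>
        RAM.encPair (MU.encInst p.1) (RAM.encVec p.2.1))
      fun p => RAM.encVec (p.1.ofEDRSol p.2)) :
    MinProblem.IsExactReduction MU EDR toEDR ofEDRSol where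
  polyTime_fst := h₁
  polyTime_snd := h₂
  metric_eq I v := congrArg hammingNorm (sub_mulVec_ofEDRSol I v)
  opt_le I := MinProblem.opt_le_opt fun x =>
    ⟨⟨MUInst.y I - MUInst.A I *ᵥ x, nullProj_mulVec_sub I x⟩, rfl⟩

end MUInst

namespace RAM

/-! ## Running times from bounds on the registers -/

/-- All variables and array cells are at most `M` in absolute value. -/
def State.Bdd (M : ℕ) (σ : State) : Prop :=
  (∀ x, (σ.var x).natAbs ≤ M) ∧ ∀ a i, (σ.arr a i).natAbs ≤ M

/-- An exponent `d` such that the value of the expression is at most `M ^ d` whenever the registers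
are at most `M`. -/
def Expr.deg : Expr → ℕ
  | .const c => c.natAbs + 1
  | .var _ => 1
  | .get _ _ => 1
  | .add e₁ e₂ => e₁.deg + e₂.deg
  | .sub e₁ e₂ => e₁.deg + e₂.deg
  | .mul e₁ e₂ => e₁.deg + e₂.deg
  | .div e₁ e₂ => e₁.deg + e₂.deg

/-- A bound for the cost of the evaluation, in units of the bit length of the registers. -/
def Expr.weight : Expr → ℕ
  | .const c => c.natAbs + 1
  | .var _ => 1
  | .get _ e => e.weight + 1
  | .add e₁ e₂ => e₁.weight + e₂.weight + (e₁.deg + e₂.deg)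
  | .sub e₁ e₂ => e₁.weight + e₂.weight + (e₁.deg + e₂.deg)
  | .mul e₁ e₂ => e₁.weight + e₂.weight + (e₁.deg + e₂.deg)
  | .div e₁ e₂ => e₁.weight + e₂.weight + (e₁.deg + e₂.deg)

theorem Expr.deg_pos (e : Expr) : 0 < e.deg := by
  induction e <;> simp only [Expr.deg] <;> omega

section ExprBounds

variable {M : ℕ} (hM : 2 ≤ M) {σ : State} (h : σ.Bdd M)
include hM h

theorem Expr.natAbs_eval_le (e : Expr) : (e.eval σ).natAbs ≤ M ^ e.deg := by
  have add_pow_le (e₁ e₂ : Expr) : M ^ e₁.deg + M ^ e₂.deg ≤ M ^ (e₁.deg + e₂.deg) := by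
    rw [pow_add]
    exact Nat.add_le_mul (hM.trans (Nat.le_self_pow e₁.deg_pos.ne' M))
      (hM.trans (Nat.le_self_pow e₂.deg_pos.ne' M))
  induction e with
  | const c =>
    calc c.natAbs ≤ 2 ^ (c.natAbs + 1) :=
          Nat.lt_two_pow_self.le.trans (Nat.pow_le_pow_right two_pos (Nat.le_succ _))
      _ ≤ M ^ (c.natAbs + 1) := Nat.pow_le_pow_left hM _
  | var x => exact (h.1 x).trans_eq (pow_one M).symm
  | get a e _ => exact (h.2 a _).trans_eq (pow_one M).symm
  | add e₁ e₂ h₁ h₂ =>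
    exact (Int.natAbs_add_le _ _).trans ((add_le_add h₁ h₂).trans (add_pow_le e₁ e₂))
  | sub e₁ e₂ h₁ h₂ =>
    exact (Int.natAbs_sub_le _ _).trans ((add_le_add h₁ h₂).trans (add_pow_le e₁ e₂))
  | mul e₁ e₂ h₁ h₂ =>
    rw [Expr.eval, Expr.deg, Int.natAbs_mul, pow_add]
    exact Nat.mul_le_mul h₁ h₂
  | div e₁ e₂ h₁ _ =>
    exact (Int.natAbs_ediv_le_natAbs _ _).trans
      (h₁.trans (Nat.pow_le_pow_right (by omega) (Nat.le_add_right _ _)))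

theorem Expr.bitLen_eval_le (e : Expr) : bitLen (e.eval σ) ≤ e.deg * (Nat.size M + 1) := by
  have h_size : Nat.size (e.eval σ).natAbs ≤ e.deg * Nat.size M := by
    rw [Nat.size_le]
    calc (e.eval σ).natAbs ≤ M ^ e.deg := e.natAbs_eval_le hM h
      _ < (2 ^ Nat.size M) ^ e.deg := Nat.pow_lt_pow_left (Nat.lt_size_self M) e.deg_pos.ne'
      _ = 2 ^ (e.deg * Nat.size M) := by rw [← pow_mul, mul_comm]
  have := e.deg_pos
  rw [bitLen, mul_add]
  omega

theorem Expr.cost_le (e : Expr) : e.cost σ ≤ e.weight * (Nat.size M + 1) := by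
  have h_eval := Expr.bitLen_eval_le hM h
  have add_le {s a b c a' b' c' : ℕ} (ha : a ≤ a' * s) (hb : b ≤ b' * s) (hc : c ≤ c' * s) :
      a + b + c ≤ (a' + b' + c') * s := by
    rw [add_mul, add_mul]
    exact add_le_add (add_le_add ha hb) hc
  induction e with
  | const c => exact h_eval (.const c)
  | var x => exact h_eval (.var x)
  | get a e ih => exact (add_le_add ih (h_eval (.get a e))).trans_eq (add_mul _ _ _).symm
  | add e₁ e₂ h₁ h₂ => exact add_le h₁ h₂ (h_eval (.add e₁ e₂))
  | sub e₁ e₂ h₁ h₂ => exact add_le h₁ h₂ (h_eval (.sub e₁ e₂))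
  | mul e₁ e₂ h₁ h₂ => exact add_le h₁ h₂ (h_eval (.mul e₁ e₂))
  | div e₁ e₂ h₁ h₂ => exact add_le h₁ h₂ (h_eval (.div e₁ e₂))

end ExprBounds

/-- A bound for the running time of a program all of whose loops are passed at most `K` times, in
units of the bit length of the registers. -/
def Prog.weight (K : ℕ) : Prog → ℕ
  | .skip => 1
  | .assign _ e => 1 + e.weight
  | .store _ i e => 1 + i.weight + e.weight
  | .write e => 1 + e.weight
  | .seq p q => p.weight K + q.weight K
  | .ifPos e p q => 1 + e.weight + (p.weight K + q.weight K)
  | .whilePos e p => (K + 1) * (1 + e.weight + p.weight K)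

theorem Prog.exists_weight_eq (p : Prog) :
    ∃ q : Polynomial ℕ, ∀ K, p.weight K = q.eval K := by
  induction p with
  | skip => exact ⟨1, fun K => by simp [Prog.weight]⟩
  | assign x e => exact ⟨Polynomial.C (1 + e.weight), fun K => by simp [Prog.weight]⟩
  | store a i e =>
    exact ⟨Polynomial.C (1 + i.weight + e.weight), fun K => by simp [Prog.weight]⟩
  | write e => exact ⟨Polynomial.C (1 + e.weight), fun K => by simp [Prog.weight]⟩
  | seq p q hp hq =>
    obtain ⟨f, hf⟩ := hp
    obtain ⟨g, hg⟩ := hq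
    exact ⟨f + g, fun K => by simp [Prog.weight, hf, hg]⟩
  | ifPos e p q hp hq =>
    obtain ⟨f, hf⟩ := hp
    obtain ⟨g, hg⟩ := hq
    exact ⟨Polynomial.C (1 + e.weight) + (f + g), fun K => by simp [Prog.weight, hf, hg]⟩
  | whilePos e p hp =>
    obtain ⟨f, hf⟩ := hp
    exact ⟨(Polynomial.X + 1) * (Polynomial.C (1 + e.weight) + f), fun K => by
      simp [Prog.weight, hf]⟩

/-- A bound for the absolute values of the registers and a bound for the number of passes through a
loop. The last field allows for the Euclidean algorithm on registers. -/
structure Limits where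
  bound : ℕ
  passes : ℕ
  two_le_bound : 2 ≤ bound
  passes_le_bound : passes ≤ bound
  two_mul_size_le : 2 * Nat.size bound ≤ passes

/-- Started in `σ`, the program `p` halts in `σ'`, and does so within the limits `B` if `σ` is. -/
def Exec (B : Limits) (p : Prog) (σ σ' : State) : Prop :=
  σ.Bdd B.bound → σ'.Bdd B.bound ∧
    ∃ t, Runs p σ σ' t ∧ t ≤ p.weight B.passes * (Nat.size B.bound + 1)

variable {B : Limits}

theorem Exec.skip (σ : State) : Exec B .skip σ σ :=
  fun h => ⟨h, 1, .skip σ, by simp [Prog.weight]⟩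

theorem Exec.seq {p q : Prog} {σ σ' σ'' : State} (hp : Exec B p σ σ') (hq : Exec B q σ' σ'') :
    Exec B (.seq p q) σ σ'' := by
  intro h
  obtain ⟨h', t, ht, ht_le⟩ := hp h
  obtain ⟨h'', t', ht', ht'_le⟩ := hq h'
  exact ⟨h'', t + t', .seq ht ht', by rw [Prog.weight, add_mul]; omega⟩

theorem State.Bdd.setVar {M : ℕ} {σ : State} (h : σ.Bdd M) (x : ℕ) {v : ℤ} (hv : v.natAbs ≤ M) :
    (σ.setVar x v).Bdd M := by
  refine ⟨fun y => ?_, h.2⟩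
  simp only [State.setVar, Function.update_apply]
  split_ifs
  exacts [hv, h.1 y]

theorem State.Bdd.setArr {M : ℕ} {σ : State} (h : σ.Bdd M) (a : ℕ) (i : ℤ) {v : ℤ}
    (hv : v.natAbs ≤ M) : (σ.setArr a i v).Bdd M := by
  refine ⟨h.1, fun b j => ?_⟩
  by_cases hb : b = a
  · subst hb
    simp only [State.setArr, Function.update_self, Function.update_apply]
    split_ifs
    exacts [hv, h.2 b j]
  · simp only [State.setArr, Function.update_of_ne hb, h.2 b j]

theorem Exec.assign {x : ℕ} {e : Expr} {σ : State} (hv : (e.eval σ).natAbs ≤ B.bound) :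
    Exec B (.assign x e) σ (σ.setVar x (e.eval σ)) := by
  intro h
  refine ⟨h.setVar x hv, _, .assign x e σ, ?_⟩
  have := e.cost_le B.two_le_bound h
  rw [Prog.weight, add_mul]
  omega

theorem Exec.store {a : ℕ} {i e : Expr} {σ : State} (hv : (e.eval σ).natAbs ≤ B.bound) :
    Exec B (.store a i e) σ (σ.setArr a (i.eval σ) (e.eval σ)) := by
  intro h
  refine ⟨h.setArr a _ hv, _, .store a i e σ, ?_⟩
  have := e.cost_le B.two_le_bound h
  have := i.cost_le B.two_le_bound h
  rw [Prog.weight, add_mul, add_mul]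
  omega

theorem Exec.write {e : Expr} {σ : State} : Exec B (.write e) σ (σ.write (e.eval σ)) := by
  intro h
  refine ⟨h, _, .write e σ, ?_⟩
  have := e.cost_le B.two_le_bound h
  rw [Prog.weight, add_mul]
  omega

theorem Exec.ifPos {e : Expr} {p q : Prog} {σ σ' : State} (hp : 0 < e.eval σ → Exec B p σ σ')
    (hq : ¬ 0 < e.eval σ → Exec B q σ σ') : Exec B (.ifPos e p q) σ σ' := by
  intro h
  have := e.cost_le B.two_le_bound h
  rw [Prog.weight, add_mul, add_mul, add_mul]
  by_cases he : 0 < e.eval σ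
  · obtain ⟨h', t, ht, ht_le⟩ := hp he h
    exact ⟨h', _, .ifTrue he ht, by omega⟩
  · obtain ⟨h', t, ht, ht_le⟩ := hq he h
    exact ⟨h', _, .ifFalse he ht, by omega⟩

theorem Exec.whilePos {e : Expr} {p : Prog} (F : ℕ → State) {n : ℕ} (hn : n ≤ B.passes)
    (h_test : ∀ k < n, 0 < e.eval (F k)) (hp : ∀ k < n, Exec B p (F k) (F (k + 1)))
    (h_stop : ¬ 0 < e.eval (F n)) : Exec B (.whilePos e p) (F 0) (F n) := by
  have h_from : ∀ j k, j + k = n → (F k).Bdd B.bound → (F n).Bdd B.bound ∧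
      ∃ t, Runs (.whilePos e p) (F k) (F n) t ∧
        t ≤ (j + 1) * (1 + e.weight + p.weight B.passes) * (Nat.size B.bound + 1) := by
    intro j
    induction j with
    | zero =>
      intro k hk h
      obtain rfl : k = n := by omega
      refine ⟨h, _, .whileFalse h_stop, ?_⟩
      have := e.cost_le B.two_le_bound h
      rw [zero_add, one_mul, add_mul, add_mul]
      omega
    | succ j ih =>
      intro k hk h
      obtain ⟨h', t, ht, ht_le⟩ := hp k (by omega) h
      obtain ⟨h'', t', ht', ht'_le⟩ := ih (k + 1) (by omega) h'
      refine ⟨h'', _, .whileTrue (h_test k (by omega)) ht ht', ?_⟩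
      have := e.cost_le B.two_le_bound h
      have h_split : (j + 1 + 1) * (1 + e.weight + p.weight B.passes) * (Nat.size B.bound + 1) =
          (j + 1) * (1 + e.weight + p.weight B.passes) * (Nat.size B.bound + 1) +
            ((Nat.size B.bound + 1) + e.weight * (Nat.size B.bound + 1) +
              p.weight B.passes * (Nat.size B.bound + 1)) := by ring
      omega
  intro h
  obtain ⟨h', t, ht, ht_le⟩ := h_from n 0 (by omega) h
  refine ⟨h', t, ht, ht_le.trans ?_⟩
  rw [Prog.weight]
  gcongr

/-- `for x < N do p`; the counter `x` is `0` before and afterwards. -/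
def Prog.loop (x : ℕ) (N : Expr) (p : Prog) : Prog :=
  .seq (.whilePos (.sub N (.var x)) (.seq p (.assign x (.add (.var x) (.const 1)))))
    (.assign x (.const 0))

theorem State.setVar_setVar (σ : State) (x : ℕ) (v w : ℤ) :
    (σ.setVar x v).setVar x w = σ.setVar x w := by
  simp only [State.setVar, Function.update_idem]

theorem State.setVar_self {σ : State} {x : ℕ} {v : ℤ} (h : σ.var x = v) : σ.setVar x v = σ := by
  rw [State.setVar, ← h, Function.update_eq_self]

theorem State.var_setVar (σ : State) (x : ℕ) (v : ℤ) : (σ.setVar x v).var x = v :=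
  Function.update_self _ _ _

theorem Exec.loop {x : ℕ} {N : Expr} {p : Prog} (F : ℕ → State) {n : ℕ} (hn : n ≤ B.passes)
    (h_zero : ∀ k, (F k).var x = 0) (hN : ∀ k ≤ n, N.eval ((F k).setVar x k) = n)
    (hp : ∀ k < n, Exec B p ((F k).setVar x k) ((F (k + 1)).setVar x k)) :
    Exec B (.loop x N p) (F 0) (F n) := by
  have h_passes := B.passes_le_bound
  have h_while := Exec.whilePos (e := .sub N (.var x))
    (p := .seq p (.assign x (.add (.var x) (.const 1)))) (fun k => (F k).setVar x (k : ℤ)) hn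
    (fun k hk => by simp only [Expr.eval, hN k hk.le, State.var_setVar]; omega)
    (fun k hk => by
      refine (hp k hk).seq ?_
      have h_incr := Exec.assign (B := B) (x := x) (e := .add (.var x) (.const 1))
        (σ := (F (k + 1)).setVar x k) (by simp only [Expr.eval, State.var_setVar]; omega)
      simpa only [Expr.eval, State.var_setVar, State.setVar_setVar, Nat.cast_succ] using h_incr)
    (by simp only [Expr.eval, hN n le_rfl, State.var_setVar]; omega)
  have h_reset := Exec.assign (B := B) (x := x) (e := .const 0) (σ := (F n).setVar x n)
    (Nat.zero_le _)
  simp only [Nat.cast_zero, State.setVar_self (h_zero 0)] at h_while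
  simp only [Expr.eval, State.setVar_setVar, State.setVar_self (h_zero n)] at h_reset
  exact h_while.seq h_reset

theorem eval_mono (q : Polynomial ℕ) : Monotone fun a => q.eval a := fun a b hab => by
  simp only [Polynomial.eval_eq_sum]
  exact Finset.sum_le_sum fun i _ => Nat.mul_le_mul_left _ (Nat.pow_le_pow_left hab i)

theorem polyTime_of_exec {α : Type} {input output : α → List ℤ} (p : Prog) (X : Polynomial ℕ)
    (h : ∀ a, ∃ B : Limits, Nat.size B.bound + 1 ≤ X.eval (wordSize (input a)) ∧
      B.passes ≤ X.eval (wordSize (input a)) ∧ (init (input a)).Bdd B.bound ∧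
      ∃ σ, Exec B p (init (input a)) σ ∧ σ.out = output a) :
    PolyTime input output := by
  obtain ⟨f, hf⟩ := p.exists_weight_eq
  refine ⟨p, f.comp X * X, fun a => ?_⟩
  obtain ⟨B, h_size, h_passes, h_init, σ, hσ, h_out⟩ := h a
  obtain ⟨-, t, ht, ht_le⟩ := hσ h_init
  refine ⟨σ, t, ht, h_out, ht_le.trans ?_⟩
  rw [Polynomial.eval_mul, Polynomial.eval_comp, hf]
  exact Nat.mul_le_mul (eval_mono f h_passes) h_size

/-! ## Named registers -/

instance : Add Expr := ⟨.add⟩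
instance : Sub Expr := ⟨.sub⟩
instance : Mul Expr := ⟨.mul⟩
instance : Div Expr := ⟨.div⟩
instance (k : ℕ) : OfNat Expr k := ⟨.const k⟩

namespace Expr

variable (σ : State) (e₁ e₂ : Expr)

@[simp] theorem eval_add : (e₁ + e₂).eval σ = e₁.eval σ + e₂.eval σ := rfl
@[simp] theorem eval_sub : (e₁ - e₂).eval σ = e₁.eval σ - e₂.eval σ := rfl
@[simp] theorem eval_mul : (e₁ * e₂).eval σ = e₁.eval σ * e₂.eval σ := rfl
@[simp] theorem eval_div : (e₁ / e₂).eval σ = e₁.eval σ / e₂.eval σ := rfl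
@[simp] theorem eval_ofNat (k : ℕ) : (no_index (OfNat.ofNat k) : Expr).eval σ = k := rfl

-- Variable `0` and array `0` are where the machine puts the length and the letters of the input.
abbrev len : Expr := .var 0
abbrev L : Expr := .var 1
abbrev m : Expr := .var 2
abbrev n : Expr := .var 3
abbrev c : Expr := .var 4
abbrev d : Expr := .var 5
abbrev b : Expr := .var 6
abbrev k : Expr := .var 7
abbrev i : Expr := .var 8
abbrev j : Expr := .var 9
abbrev s : Expr := .var 10
abbrev x : Expr := .var 11
abbrev y : Expr := .var 12
abbrev u : Expr := .var 13
abbrev v : Expr := .var 14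
abbrev inp (p : Expr) : Expr := .get 0 p
abbrev S (p : Expr) : Expr := .get 1 p
abbrev Q (p : Expr) : Expr := .get 2 p
abbrev a (p : Expr) : Expr := .get 3 p
abbrev w (p : Expr) : Expr := .get 4 p

end Expr

/-- The registers that carry values from one procedure to the next. -/
structure Regs where
  len : ℤ := 0
  L : ℤ := 0
  m : ℤ := 0
  n : ℤ := 0
  c : ℤ := 0
  d : ℤ := 0
  b : ℤ := 0
  k : ℤ := 0
  inp : ℤ → ℤ := 0
  S : ℤ → ℤ := 0
  Q : ℤ → ℤ := 0
  a : ℤ → ℤ := 0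
  w : ℤ → ℤ := 0
  out : List ℤ := []

/-- The registers that are zero before and after every procedure. -/
structure Scratch where
  i : ℤ := 0
  j : ℤ := 0
  s : ℤ := 0
  x : ℤ := 0
  y : ℤ := 0
  u : ℤ := 0
  v : ℤ := 0

namespace Regs

/-- The variables of the machine. -/
@[simp] def varAt (r : Regs) (t : Scratch) : ℕ → ℤ
  | 0 => r.len
  | 1 => r.L
  | 2 => r.m
  | 3 => r.n
  | 4 => r.c
  | 5 => r.d
  | 6 => r.b
  | 7 => r.k
  | 8 => t.i
  | 9 => t.j
  | 10 => t.s
  | 11 => t.x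
  | 12 => t.y
  | 13 => t.u
  | 14 => t.v
  | _ => 0

/-- The arrays of the machine. -/
@[simp] def arrAt (r : Regs) : ℕ → ℤ → ℤ
  | 0 => r.inp
  | 1 => r.S
  | 2 => r.Q
  | 3 => r.a
  | 4 => r.w
  | _ => 0

/-- The state of the machine with these registers. -/
def state (r : Regs) (t : Scratch := {}) : State := ⟨r.varAt t, r.arrAt, r.out⟩

variable (r : Regs) (t : Scratch)

@[simp] theorem eval_var (x : ℕ) : (Expr.var x).eval (r.state t) = r.varAt t x := rfl

@[simp] theorem eval_get (a : ℕ) (p : Expr) :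
    (Expr.get a p).eval (r.state t) = r.arrAt a (p.eval (r.state t)) := rfl

theorem setVar_eq {r r' : Regs} {t t' : Scratch} {x : ℕ} {v : ℤ}
    (h : ∀ y ≠ x, r.varAt t y = r'.varAt t' y) (hx : r'.varAt t' x = v) (ha : r.arrAt = r'.arrAt)
    (ho : r.out = r'.out) : (r.state t).setVar x v = r'.state t' := by
  have h_update : Function.update (r.varAt t) x v = r'.varAt t' :=
    Function.update_eq_iff.2 ⟨hx.symm, h⟩
  simp only [state, State.setVar, h_update, ha, ho]

theorem setArr_eq {r r' : Regs} {a : ℕ} {i v : ℤ} (h : ∀ b ≠ a, r.arrAt b = r'.arrAt b)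
    (ha : r'.arrAt a = Function.update (r.arrAt a) i v) (hv : r.varAt t = r'.varAt t)
    (ho : r.out = r'.out) : (r.state t).setArr a i v = r'.state t := by
  have h_update : Function.update r.arrAt a (Function.update (r.arrAt a) i v) = r'.arrAt :=
    Function.update_eq_iff.2 ⟨ha.symm, h⟩
  simp only [state, State.setArr, h_update, hv, ho]

variable (q : ℤ)

theorem set_L : (r.state t).setVar 1 q = { r with L := q }.state t :=
  setVar_eq (fun y hy => by unfold varAt; split <;> first | rfl | exact absurd rfl hy) rfl rfl rfl

theorem set_m : (r.state t).setVar 2 q = { r with m := q }.state t :=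
  setVar_eq (fun y hy => by unfold varAt; split <;> first | rfl | exact absurd rfl hy) rfl rfl rfl

theorem set_n : (r.state t).setVar 3 q = { r with n := q }.state t :=
  setVar_eq (fun y hy => by unfold varAt; split <;> first | rfl | exact absurd rfl hy) rfl rfl rfl

theorem set_c : (r.state t).setVar 4 q = { r with c := q }.state t :=
  setVar_eq (fun y hy => by unfold varAt; split <;> first | rfl | exact absurd rfl hy) rfl rfl rfl

theorem set_d : (r.state t).setVar 5 q = { r with d := q }.state t :=
  setVar_eq (fun y hy => by unfold varAt; split <;> first | rfl | exact absurd rfl hy) rfl rfl rfl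

theorem set_b : (r.state t).setVar 6 q = { r with b := q }.state t :=
  setVar_eq (fun y hy => by unfold varAt; split <;> first | rfl | exact absurd rfl hy) rfl rfl rfl

theorem set_k : (r.state t).setVar 7 q = { r with k := q }.state t :=
  setVar_eq (fun y hy => by unfold varAt; split <;> first | rfl | exact absurd rfl hy) rfl rfl rfl

theorem set_i : (r.state t).setVar 8 q = r.state { t with i := q } :=
  setVar_eq (fun y hy => by unfold varAt; split <;> first | rfl | exact absurd rfl hy) rfl rfl rfl

theorem set_j : (r.state t).setVar 9 q = r.state { t with j := q } :=
  setVar_eq (fun y hy => by unfold varAt; split <;> first | rfl | exact absurd rfl hy) rfl rfl rfl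

theorem set_s : (r.state t).setVar 10 q = r.state { t with s := q } :=
  setVar_eq (fun y hy => by unfold varAt; split <;> first | rfl | exact absurd rfl hy) rfl rfl rfl

theorem set_x : (r.state t).setVar 11 q = r.state { t with x := q } :=
  setVar_eq (fun y hy => by unfold varAt; split <;> first | rfl | exact absurd rfl hy) rfl rfl rfl

theorem set_y : (r.state t).setVar 12 q = r.state { t with y := q } :=
  setVar_eq (fun y hy => by unfold varAt; split <;> first | rfl | exact absurd rfl hy) rfl rfl rfl

theorem set_u : (r.state t).setVar 13 q = r.state { t with u := q } :=
  setVar_eq (fun y hy => by unfold varAt; split <;> first | rfl | exact absurd rfl hy) rfl rfl rfl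

theorem set_v : (r.state t).setVar 14 q = r.state { t with v := q } :=
  setVar_eq (fun y hy => by unfold varAt; split <;> first | rfl | exact absurd rfl hy) rfl rfl rfl

variable (o : ℤ)

theorem store_S : (r.state t).setArr 1 o q = { r with S := Function.update r.S o q }.state t :=
  setArr_eq t (fun y hy => by unfold arrAt; split <;> first | rfl | exact absurd rfl hy) rfl rfl rfl

theorem store_Q : (r.state t).setArr 2 o q = { r with Q := Function.update r.Q o q }.state t :=
  setArr_eq t (fun y hy => by unfold arrAt; split <;> first | rfl | exact absurd rfl hy) rfl rfl rfl

theorem store_a : (r.state t).setArr 3 o q = { r with a := Function.update r.a o q }.state t :=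
  setArr_eq t (fun y hy => by unfold arrAt; split <;> first | rfl | exact absurd rfl hy) rfl rfl rfl

theorem store_w : (r.state t).setArr 4 o q = { r with w := Function.update r.w o q }.state t :=
  setArr_eq t (fun y hy => by unfold arrAt; split <;> first | rfl | exact absurd rfl hy) rfl rfl rfl

end Regs

variable {B : Limits} {r r' : Regs} {t t' : Scratch}

theorem Exec.set {x : ℕ} {e : Expr} {v : ℤ} (h : (r.state t).setVar x v = r'.state t')
    (hv : e.eval (r.state t) = v) (hb : v.natAbs ≤ B.bound) :
    Exec B (.assign x e) (r.state t) (r'.state t') := by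
  rw [← h, ← hv]
  exact Exec.assign (hv ▸ hb)

theorem Exec.put {a : ℕ} {p e : Expr} {i v : ℤ} (h : (r.state t).setArr a i v = r'.state t')
    (hi : p.eval (r.state t) = i) (hv : e.eval (r.state t) = v) (hb : v.natAbs ≤ B.bound) :
    Exec B (.store a p e) (r.state t) (r'.state t') := by
  rw [← h, ← hv, ← hi]
  exact Exec.store (hv ▸ hb)

theorem Exec.emit {e : Expr} {v : ℤ} (hv : e.eval (r.state t) = v) :
    Exec B (.write e) (r.state t) ({ r with out := r.out ++ [v] }.state t) :=
  hv ▸ Exec.write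

theorem Exec.for_i {N : Expr} {p : Prog} (F : ℕ → Regs) (ht : t.i = 0) {n : ℕ}
    (hn : n ≤ B.passes) (hN : ∀ k ≤ n, N.eval ((F k).state { t with i := k }) = n)
    (hp : ∀ k < n, Exec B p ((F k).state { t with i := k }) ((F (k + 1)).state { t with i := k })) :
    Exec B (.loop 8 N p) ((F 0).state t) ((F n).state t) :=
  Exec.loop (fun k => (F k).state t) hn (fun _ => ht) (fun k hk => by rw [Regs.set_i, hN k hk])
    fun k hk => by rw [Regs.set_i, Regs.set_i]; exact hp k hk

/-! ## Arrays -/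

/-- The array `g` with its first `N` entries replaced by those of `f`. -/
def fill (N : ℕ) (f : ℕ → ℤ) (g : ℤ → ℤ) (p : ℤ) : ℤ :=
  if 0 ≤ p ∧ p < N then f p.toNat else g p

theorem fill_zero (f : ℕ → ℤ) (g : ℤ → ℤ) : fill 0 f g = g := by
  funext p
  rw [fill, if_neg (by omega)]

theorem fill_natCast {N : ℕ} (f : ℕ → ℤ) (g : ℤ → ℤ) {i : ℕ} (hi : i < N) : fill N f g i = f i := by
  rw [fill, if_pos (by omega), Int.toNat_natCast]

theorem fill_natCast_of_le {N : ℕ} (f : ℕ → ℤ) (g : ℤ → ℤ) {i : ℕ} (hi : N ≤ i) :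
    fill N f g i = g i := by
  rw [fill, if_neg (by omega)]

theorem update_fill (N : ℕ) (f : ℕ → ℤ) (g : ℤ → ℤ) :
    Function.update (fill N f g) (N : ℤ) (f N) = fill (N + 1) f g := by
  funext p
  by_cases hp : p = N
  · subst hp
    rw [Function.update_self, fill_natCast _ _ (by omega)]
  · rw [Function.update_of_ne hp, fill, fill]
    exact if_congr (by omega) rfl rfl

theorem fill_fill (N : ℕ) (f f' : ℕ → ℤ) (g : ℤ → ℤ) : fill N f (fill N f' g) = fill N f g := by
  funext p
  rw [fill, fill, fill]
  split_ifs <;> rfl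

theorem fill_natCast_mul_add {m c : ℕ} (q : ℕ → ℕ → ℤ) (g : ℤ → ℤ) {i j : ℕ} (hi : i < m)
    (hj : j < c) : fill (m * c) (fun p => q (p / c) (p % c)) g ((i : ℤ) * c + j) = q i j := by
  have h_lt : i * c + j < m * c := by nlinarith
  have h_fill := fill_natCast (fun p => q (p / c) (p % c)) g h_lt
  rwa [mul_comm i c, Nat.mul_add_div (by omega), Nat.div_eq_of_lt hj, Nat.mul_add_mod,
    Nat.mod_eq_of_lt hj, add_zero, mul_comm c i, Nat.cast_add, Nat.cast_mul] at h_fill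

/-- Fills the first `N` entries of the array `a` with the values of `e` for the values of `i`. -/
def Prog.tabulate (a : ℕ) (N e : Expr) : Prog := .loop 8 N (.store a .i e)

theorem Exec.tabulate {a : ℕ} {N e : Expr} (F : (ℤ → ℤ) → Regs)
    (hF : ∀ g t i v, ((F g).state t).setArr a i v = (F (Function.update g i v)).state t)
    (ht : t.i = 0) {n : ℕ} (hn : n ≤ B.passes) (f : ℕ → ℤ) {g : ℤ → ℤ}
    (hN : ∀ g i, N.eval ((F g).state { t with i := i }) = n)
    (he : ∀ k < n, e.eval ((F (fill k f g)).state { t with i := k }) = f k)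
    (hb : ∀ k < n, (f k).natAbs ≤ B.bound) :
    Exec B (.tabulate a N e) ((F g).state t) ((F (fill n f g)).state t) := by
  have h_loop := Exec.for_i (N := N) (p := .store a .i e) (fun k => F (fill k f g)) ht hn
    (fun k _ => hN _ _) fun k hk => by
      rw [← update_fill]
      exact .put (hF _ _ _ _) rfl (he k hk) (hb k hk)
  rwa [fill_zero] at h_loop

/-- The row of the entry with number `i` of a matrix with `c` columns. -/
def Expr.row (c : Expr) : Expr := .i / c

/-- The column of the entry with number `i` of a matrix with `c` columns. -/
def Expr.col (c : Expr) : Expr := .i - .i / c * c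

@[simp] theorem Expr.eval_row (e : Expr) :
    (Expr.row e).eval (r.state t) = t.i / e.eval (r.state t) := rfl

@[simp] theorem Expr.eval_col (e : Expr) :
    (Expr.col e).eval (r.state t) = t.i % e.eval (r.state t) := by
  rw [Int.emod_def, mul_comm]
  rfl

/-- The indicator of `e = 0`. -/
def Expr.isZero (e : Expr) : Expr := 1 - e / e

theorem Expr.eval_isZero (σ : State) (e : Expr) :
    e.isZero.eval σ = if e.eval σ = 0 then 1 else 0 := by
  rw [Expr.isZero, Expr.eval_sub, Expr.eval_div, Expr.eval_ofNat]
  split_ifs with h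
  · rw [h, Int.ediv_zero, Nat.cast_one, sub_zero]
  · rw [Int.ediv_self h, Nat.cast_one, sub_self]

/-! ## Elimination -/

/-- Adds the products of `e₁` and `e₂`, for `j` from `0` to `c - 1`, to `s`. -/
def Prog.dot (e₁ e₂ : Expr) : Prog := .loop 9 .c (.assign 10 (.s + e₁ * e₂))

theorem Exec.dot {e₁ e₂ : Expr} {c : ℕ} (hc : r.c = c) (h_passes : c ≤ B.passes) {f g : ℕ → ℤ}
    (h₁ : ∀ k < c, ∀ q, e₁.eval (r.state { t with j := k, s := q }) = f k)
    (h₂ : ∀ k < c, ∀ q, e₂.eval (r.state { t with j := k, s := q }) = g k)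
    (hb : ∀ k ≤ c, (dotN k f g).natAbs ≤ B.bound) :
    Exec B (.dot e₁ e₂) (r.state { t with j := 0, s := 0 })
      (r.state { t with j := 0, s := dotN c f g }) := by
  refine Exec.loop (fun k => r.state { t with j := 0, s := dotN k f g }) h_passes (fun _ => rfl)
    (fun _ _ => hc) fun k hk => ?_
  rw [Regs.set_j, Regs.set_j]
  refine .set (Regs.set_s _ _ _) ?_ (hb (k + 1) hk)
  rw [Expr.eval_add, Expr.eval_mul, h₁ k hk, h₂ k hk, dotN_succ]
  rfl

/-- Sets `w` to the product of the matrix `Q` and row `k` of `a`. -/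
def Prog.matvec : Prog :=
  .loop 8 .c (.seq (.dot (.Q (.i * .c + .j)) (.a (.k * .c + .j)))
    (.seq (.store 4 .i .s) (.assign 10 0)))

theorem Exec.matvec {c : ℕ} (hc : r.c = c) (h_passes : c ≤ B.passes) {F : FracMatrix} {f : ℕ → ℤ}
    (hQ : ∀ i < c, ∀ j < c, r.Q ((i : ℤ) * c + j) = F.num i j)
    (ha : ∀ j < c, r.a (r.k * c + j) = f j)
    (hb : ∀ i < c, ∀ k ≤ c, (F.numMulVec k f i).natAbs ≤ B.bound) :
    Exec B .matvec r.state { r with w := fill c (F.numMulVec c f) r.w }.state := by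
  have h_loop := Exec.for_i (fun k => { r with w := fill k (F.numMulVec c f) r.w }) (t := {}) rfl
    h_passes (N := .c) (fun _ _ => hc)
    (p := .seq (.dot (.Q (.i * .c + .j)) (.a (.k * .c + .j)))
      (.seq (.store 4 .i .s) (.assign 10 0)))
    fun i hi => by
      have h_dot := Exec.dot (B := B) (e₁ := .Q (.i * .c + .j)) (e₂ := .a (.k * .c + .j))
        (r := { r with w := fill i (F.numMulVec c f) r.w }) (t := { i := i }) hc h_passes
        (fun j hj q => by simp [hc, hQ i hi j hj]) (fun j hj q => by simp [hc, ha j hj]) (hb i hi)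
      rw [← update_fill]
      exact h_dot.seq (.seq (.put (Regs.store_w _ _ _ _) rfl rfl (hb i hi c le_rfl))
        (.set (Regs.set_s _ _ _) rfl (Nat.zero_le _)))
  rwa [fill_zero] at h_loop

/-- The registers with `Q / d` set to the projection `F`. -/
def Regs.withProj (r : Regs) (c : ℕ) (F : FracMatrix) : Regs :=
  { r with Q := fill (c * c) (fun p => F.num (p / c) (p % c)) r.Q, d := F.den }

/-- Sets `Q / d` to the unit matrix. -/
def Prog.initQ : Prog :=
  .seq (.assign 5 1) (.tabulate 2 (.c * .c) (Expr.isZero (.row .c - .col .c)))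

theorem Exec.initQ {c : ℕ} (hc : r.c = c) (h_passes : c * c ≤ B.passes) (R : ℕ → ℕ → ℤ) :
    Exec B .initQ r.state (r.withProj c (FracMatrix.elim c R 0)).state := by
  have h_one : 1 ≤ B.bound := by have := B.two_le_bound; omega
  refine .seq (.set (Regs.set_d _ _ 1) rfl h_one) (Exec.tabulate (fun Q => { r with Q, d := 1 })
    (fun _ _ _ _ => Regs.store_Q _ _ _ _) rfl h_passes _ (fun g i => by simp [hc])
    (fun k _ => ?_) fun k _ => ?_)
  · simp only [Expr.eval_isZero, Expr.eval_sub, Expr.eval_row, Expr.eval_col, Regs.eval_var,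
      Regs.varAt, hc, ← Int.natCast_ediv, ← Int.natCast_mod]
    exact if_congr (by omega) rfl rfl
  · dsimp only [FracMatrix.elim]
    split_ifs <;> simp [h_one]

/-- Restricts the projection `Q / d` to the vectors orthogonal to row `k` of `a`. -/
def Prog.elimStep : Prog :=
  .seq .matvec (.seq (.dot (.a (.k * .c + .j)) (.w .j)) (.seq
    (.ifPos .s (.seq (.tabulate 2 (.c * .c) ((.s * .Q .i - .w (.row .c) * .w (.col .c)) / .d))
      (.assign 5 .s)) .skip)
    (.assign 10 0)))

theorem Exec.updateProj {c : ℕ} (hc : r.c = c) (h_passes : c * c ≤ B.passes) {F : FracMatrix}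
    {f : ℕ → ℤ} (hw : ∀ i < c, r.w i = F.numMulVec c f i)
    (hs : (dotN c f (F.numMulVec c f)).natAbs ≤ B.bound)
    (hb : ∀ i < c, ∀ j < c, ((F.elimStep c f).num i j).natAbs ≤ B.bound) :
    Exec B (.ifPos .s (.seq
        (.tabulate 2 (.c * .c) ((.s * .Q .i - .w (.row .c) * .w (.col .c)) / .d))
        (.assign 5 .s)) .skip)
      ((r.withProj c F).state { s := dotN c f (F.numMulVec c f) })
      ((r.withProj c (F.elimStep c f)).state { s := dotN c f (F.numMulVec c f) }) := by
  refine .ifPos (fun h_pos => ?_) fun h_neg => ?_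
  · change 0 < dotN c f (F.numMulVec c f) at h_pos
    rw [FracMatrix.elimStep_of_pos h_pos] at hb ⊢
    have h_fill := Exec.tabulate (B := B) (a := 2) (N := .c * .c)
      (e := (.s * .Q .i - .w (.row .c) * .w (.col .c)) / .d)
      (fun Q => { r.withProj c F with Q }) (fun _ _ _ _ => Regs.store_Q _ _ _ _)
      (t := { s := dotN c f (F.numMulVec c f) }) rfl h_passes
      (fun p => (dotN c f (F.numMulVec c f) * F.num (p / c) (p % c) -
        F.numMulVec c f (p / c) * F.numMulVec c f (p % c)) / F.den) (g := (r.withProj c F).Q)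
      (fun g i => by simp [Regs.withProj, hc])
      (fun k hk => by
        have h_mod : k % c < c := Nat.mod_lt _ (Nat.pos_of_mul_pos_left (by omega : 0 < c * c))
        simp only [Expr.eval_div, Expr.eval_sub, Expr.eval_mul, Expr.eval_row, Expr.eval_col,
          Regs.eval_var, Regs.eval_get, Regs.varAt, Regs.arrAt, Regs.withProj, hc,
          ← Int.natCast_ediv, ← Int.natCast_mod, hw _ (Nat.div_lt_of_lt_mul hk), hw _ h_mod,
          fill_natCast_of_le _ _ le_rfl, fill_natCast _ _ hk])
      fun k hk => hb _ (Nat.div_lt_of_lt_mul hk) _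
        (Nat.mod_lt _ (Nat.pos_of_mul_pos_left (by omega : 0 < c * c)))
    have h_den := h_fill.seq (.set (e := .s) (Regs.set_d _ _ _) rfl hs)
    simp only [Regs.withProj, fill_fill] at h_den ⊢
    exact h_den
  · rw [FracMatrix.elimStep_of_not_pos h_neg]
    exact .skip _

theorem Exec.elimStep {c : ℕ} (hc : r.c = c) (h_passes : c * c ≤ B.passes) {F : FracMatrix}
    {f : ℕ → ℤ} (ha : ∀ j < c, r.a (r.k * c + j) = f j) {D E : ℕ}
    (hF : ∀ i < c, ∀ j < c, (F.num i j).natAbs ≤ D) (hf : ∀ j < c, (f j).natAbs ≤ E)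
    (h_mulVec : c * (D * E) ≤ B.bound) (h_dotN : c * (E * (c * (D * E))) ≤ B.bound)
    (hb : ∀ i < c, ∀ j < c, ((F.elimStep c f).num i j).natAbs ≤ B.bound) :
    Exec B .elimStep (r.withProj c F).state
      { r.withProj c (F.elimStep c f) with w := fill c (F.numMulVec c f) r.w }.state := by
  have h_le : c ≤ B.passes := (Nat.le_mul_self c).trans h_passes
  have h_mulVec_le (i) (hi : i < c) (k) (hk : k ≤ c) : (F.numMulVec k f i).natAbs ≤ c * (D * E) :=
    (FracMatrix.natAbs_numMulVec_le (fun j hj => hF i hi j (by omega))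
      fun j hj => hf j (by omega)).trans (Nat.mul_le_mul_right _ hk)
  have h_dot_le (k) (hk : k ≤ c) : (dotN k f (F.numMulVec c f)).natAbs ≤ B.bound :=
    ((natAbs_dotN_le (fun j hj => hf j (by omega))
      fun j hj => h_mulVec_le j (by omega) c le_rfl).trans (Nat.mul_le_mul_right _ hk)).trans h_dotN
  have h_matvec := Exec.matvec (B := B) (r := r.withProj c F) hc h_le
    (fun i hi j hj => fill_natCast_mul_add _ _ hi hj) ha
    fun i hi k hk => (h_mulVec_le i hi k hk).trans h_mulVec
  have h_update := Exec.updateProj (B := B) (r := { r with w := fill c (F.numMulVec c f) r.w }) hc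
    h_passes (fun i hi => fill_natCast _ _ hi) (h_dot_le c le_rfl) hb
  have h_dot := Exec.dot (B := B) (e₁ := .a (.k * .c + .j)) (e₂ := .w .j)
    (r := { r.withProj c F with w := fill c (F.numMulVec c f) r.w }) (t := {}) hc h_le
    (fun j hj q => by simp [Regs.withProj, hc, ha j hj])
    (fun j hj q => by simp [fill_natCast _ _ hj])
    h_dot_le
  exact h_matvec.seq (h_dot.seq (h_update.seq (.set (Regs.set_s _ _ _) rfl (Nat.zero_le _))))

theorem Exec.elim {N : Expr} {c n : ℕ} (hc : r.c = c) (hk : r.k = 0) (hcB : c * c ≤ B.passes)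
    (hnB : n ≤ B.passes) {R : ℕ → ℕ → ℤ} {E : ℕ} (hE : 1 ≤ E)
    (hR : ∀ i < n, ∀ j < c, (R i j).natAbs ≤ E) (hB : ((c + 1) * E) ^ (2 * n) ≤ B.bound)
    (hN : ∀ Q d w k, N.eval { r with Q, d, w, k }.state = n)
    (ha : ∀ i < n, ∀ j < c, r.a ((i : ℤ) * c + j) = R i j) :
    ∃ w, Exec B (.loop 7 N .elimStep) (r.withProj c (.elim c R 0)).state
      ({ r with w }.withProj c (.elim c R n)).state := by
  let W : ℕ → ℤ → ℤ := Nat.rec r.w fun k w => fill c ((FracMatrix.elim c R k).numMulVec c (R k)) w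
  refine ⟨W n, Exec.loop (fun k => ({ r with w := W k }.withProj c (.elim c R k)).state) hnB
    (fun _ => hk) (fun k _ => ?_) fun k hkn => ?_⟩
  · rw [Regs.set_k]
    exact hN _ _ _ _
  rw [Regs.set_k, Regs.set_k]
  have h_num (l) (hl : l ≤ n) (i) (hi : i < c) (j) (hj : j < c) :
      ((FracMatrix.elim c R l).num i j).natAbs ≤ ((c + 1) * E) ^ (2 * l) :=
    (FracMatrix.natAbs_elim_num_le l hi hj).trans (FracMatrix.natAbs_elim_den_le hE hR hl)
  have h_pow (l) (hl : l ≤ n) : ((c + 1) * E) ^ (2 * l) ≤ B.bound :=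
    (Nat.pow_le_pow_right (Nat.mul_pos c.succ_pos hE) (by omega)).trans hB
  have h_dot : c * (E * (c * (((c + 1) * E) ^ (2 * k) * E))) ≤ B.bound := by
    refine le_trans ?_ (h_pow (k + 1) hkn)
    rw [mul_add_one, pow_add]
    nlinarith [Nat.mul_le_mul_left (((c + 1) * E) ^ (2 * k)) (show c * E * (c * E) ≤
      ((c + 1) * E) ^ 2 by nlinarith)]
  have h_mulVec : c * (((c + 1) * E) ^ (2 * k) * E) ≤ B.bound := by
    rcases Nat.eq_zero_or_pos c with rfl | hc_pos
    · omega
    · refine le_trans ?_ h_dot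
      rw [← mul_assoc c E]
      exact Nat.le_mul_of_pos_left _ (Nat.mul_pos hc_pos hE)
  exact Exec.elimStep (r := { r with w := W k, k := k }) hc hcB (ha k hkn)
    (h_num k hkn.le) (hR k hkn) h_mulVec h_dot
    fun i hi j hj => (h_num (k + 1) hkn i hi j hj).trans (h_pow (k + 1) hkn)

/-- Sets `Q / d` to the projection onto the null space of the matrix with `N` rows, `C` columns and
the entries `e`, in terms of the number `i` of the entry. -/
def Prog.project (N C e : Expr) : Prog :=
  .seq (.assign 4 C) (.seq (.tabulate 3 (N * .c) e) (.seq .initQ (.loop 7 N .elimStep)))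

theorem Exec.project {N C e : Expr} {n c : ℕ} (hk : r.k = 0) (hcB : c * c ≤ B.passes)
    (hncB : n * c ≤ B.passes) (hnB : n ≤ B.passes) {R : ℕ → ℕ → ℤ} {E : ℕ} (hE : 1 ≤ E)
    (hR : ∀ i < n, ∀ j < c, (R i j).natAbs ≤ E) (hEB : E ≤ B.bound)
    (hB : ((c + 1) * E) ^ (2 * n) ≤ B.bound)
    (hC : C.eval r.state = c) (hN : ∀ a Q d w k t, N.eval ({ r with c, a, Q, d, w, k }.state t) = n)
    (he : ∀ k < n * c, ∀ a, e.eval ({ r with c, a }.state { i := k }) = R (k / c) (k % c)) :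
    ∃ a w, Exec B (.project N C e) r.state ({ r with c, a, w }.withProj c (.elim c R n)).state := by
  have h_sq : c ≤ B.bound := (Nat.le_mul_self c).trans (hcB.trans B.passes_le_bound)
  have h_fill := Exec.tabulate (B := B) (a := 3) (N := N * .c) (e := e) (fun a => { r with c, a })
    (fun _ _ _ _ => Regs.store_a _ _ _ _) (t := {}) rfl hncB (fun p => R (p / c) (p % c))
    (g := r.a) (fun a i => by
      rw [Expr.eval_mul, hN, Regs.eval_var]
      exact (Nat.cast_mul _ _).symm)
    (fun k hk => he k hk _)
    fun k hk => by
      have h_pos : 0 < c := Nat.pos_of_mul_pos_left (by omega : 0 < n * c)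
      exact (hR _ (Nat.div_lt_of_lt_mul (by rwa [mul_comm])) _ (Nat.mod_lt _ h_pos)).trans hEB
  obtain ⟨w, h_elim⟩ := Exec.elim (N := N)
    (r := { r with c, a := fill (n * c) (fun p => R (p / c) (p % c)) r.a }) rfl hk hcB hnB hE hR hB
    (fun _ _ _ _ => hN _ _ _ _ _ _) fun i hi j hj => fill_natCast_mul_add _ _ hi hj
  exact ⟨_, w, .seq (.set (Regs.set_c _ _ _) hC h_sq) (h_fill.seq (.seq (.initQ rfl hcB R) h_elim))⟩

/-! ## Fractions -/

/-- The product of the positive ones among the first `N` values. -/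
def posProd (f : ℕ → ℤ) (N : ℕ) : ℤ := ∏ i ∈ Finset.range N, if 0 < f i then f i else 1

theorem posProd_succ_of_pos {f : ℕ → ℤ} {k : ℕ} (h : 0 < f k) :
    posProd f (k + 1) = posProd f k * f k := by
  rw [posProd, Finset.prod_range_succ, if_pos h, posProd]

theorem posProd_succ_of_not_pos {f : ℕ → ℤ} {k : ℕ} (h : ¬ 0 < f k) :
    posProd f (k + 1) = posProd f k := by
  rw [posProd, Finset.prod_range_succ, if_neg h, mul_one, posProd]

/-- Sets `L` to the product of the positive letters of the input. -/
def Prog.posProd : Prog :=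
  .seq (.assign 1 1) (.loop 8 .len (.ifPos (.inp .i) (.assign 1 (.L * .inp .i)) .skip))

theorem Exec.posProd {n : ℕ} (hn : n ≤ B.passes) (h_len : r.len = n)
    (hb : ∀ k ≤ n, (RAM.posProd (fun i => r.inp i) k).natAbs ≤ B.bound) :
    Exec B .posProd r.state { r with L := RAM.posProd (fun i => r.inp i) n }.state := by
  refine .seq (.set (Regs.set_L _ _ 1) rfl (hb 0 (Nat.zero_le n)))
    (Exec.for_i (fun k => { r with L := RAM.posProd (fun i => r.inp i) k }) rfl hn
      (fun _ _ => h_len) fun k hk => .ifPos (fun h_pos => ?_) fun h_neg => ?_)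
  · refine .set (Regs.set_L _ _ _) ?_ (hb (k + 1) hk)
    exact (posProd_succ_of_pos (f := fun i => r.inp i) h_pos).symm
  · rw [posProd_succ_of_not_pos h_neg]
    exact .skip _

/-- Scales every letter of the input, as a numerator followed by its denominator, by `L`. -/
def Prog.scale : Prog := .tabulate 1 .len (.inp .i * (.L / .inp (.i + 1)))

theorem Exec.scale {n : ℕ} (hn : n ≤ B.passes) (h_len : r.len = n)
    (hb : ∀ k < n, (r.inp k * (r.L / r.inp (k + 1))).natAbs ≤ B.bound) :
    Exec B .scale r.state
      { r with S := fill n (fun k => r.inp k * (r.L / r.inp (k + 1))) r.S }.state :=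
  Exec.tabulate (fun S => { r with S }) (fun _ _ _ _ => Regs.store_S _ _ _ _) rfl hn _
    (fun _ _ => h_len) (fun _ _ => rfl) hb

/-- One step of Euclid's algorithm. -/
def euclid (p : ℕ × ℕ) : ℕ × ℕ := (p.2, p.1 % p.2)

theorem euclid_iterate_le {u : ℕ} {p : ℕ × ℕ} (hp : p.1 ≤ u ∧ p.2 ≤ u) (k : ℕ) :
    (euclid^[k] p).1 ≤ u ∧ (euclid^[k] p).2 ≤ u := by
  induction k with
  | zero => exact hp
  | succ k ih =>
    rw [Function.iterate_succ_apply']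
    exact ⟨ih.2, (Nat.mod_le _ _).trans ih.1⟩

theorem exists_euclid_iterate_eq (N : ℕ) : ∀ u v : ℕ, v ≤ u → u * v < 2 ^ N →
    ∃ n ≤ N, (∀ k < n, 0 < (euclid^[k] (u, v)).2) ∧ euclid^[n] (u, v) = (Nat.gcd u v, 0) := by
  induction N with
  | zero =>
    intro u v hvu h_lt
    obtain rfl : v = 0 := by nlinarith
    exact ⟨0, le_rfl, by simp, by simp⟩
  | succ N ih =>
    intro u v hvu h_lt
    rcases Nat.eq_zero_or_pos v with rfl | hv
    · exact ⟨0, by omega, by simp, by simp⟩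
    -- The product of the two numbers is halved in each step.
    have h_half : 2 * (u % v) ≤ u := by
      have h_mod := Nat.mod_lt u hv
      have h_div_mod := Nat.div_add_mod u v
      have h_div := Nat.div_pos hvu hv
      nlinarith
    obtain ⟨n, hn, h_pos, h_eq⟩ := ih v (u % v) (Nat.mod_lt u hv).le (by
      rw [pow_succ] at h_lt
      nlinarith)
    refine ⟨n + 1, by omega, ?_, ?_⟩
    · rintro (_ | k) hk
      · exact hv
      · exact h_pos k (by omega)
    · rw [Function.iterate_succ_apply, Nat.gcd_comm, Nat.gcd_rec, Nat.gcd_comm]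
      exact h_eq

/-- Sets `u` to the greatest common divisor of `u` and `v`, and `v` to zero. -/
def Prog.gcd : Prog :=
  .whilePos .v (.seq (.assign 10 (.u - .u / .v * .v)) (.seq (.assign 13 .v)
    (.seq (.assign 14 .s) (.assign 10 0))))

theorem Exec.gcd {u v : ℕ} (hvu : v ≤ u) (hu : u ≤ B.bound) :
    Exec B .gcd (r.state { t with s := 0, u := u, v := v })
      (r.state { t with s := 0, u := Nat.gcd u v, v := 0 }) := by
  obtain ⟨n, hn, h_pos, h_eq⟩ := exists_euclid_iterate_eq (2 * Nat.size B.bound) u v hvu (by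
    have h_size := Nat.lt_size_self B.bound
    rw [two_mul, pow_add]
    nlinarith)
  have h_while := Exec.whilePos (B := B) (e := .v)
    (p := .seq (.assign 10 (.u - .u / .v * .v)) (.seq (.assign 13 .v)
      (.seq (.assign 14 .s) (.assign 10 0))))
    (fun k => r.state { t with
      s := 0, u := (euclid^[k] (u, v)).1, v := (euclid^[k] (u, v)).2 })
    (hn.trans B.two_mul_size_le) (fun k hk => Int.natCast_pos.2 (h_pos k hk))
    (fun k _ => by
      have h_le := euclid_iterate_le (p := (u, v)) ⟨le_rfl, hvu⟩
      have h_mod := (h_le (k + 1)).2.trans hu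
      rw [Function.iterate_succ_apply'] at h_mod ⊢
      refine .seq (.set (Regs.set_s _ _ ((euclid (euclid^[k] (u, v))).2 : ℕ)) ?_ h_mod)
        (.seq (.set (Regs.set_u _ _ _) rfl ((h_le k).2.trans hu))
          (.seq (.set (Regs.set_v _ _ _) rfl h_mod) (.set (Regs.set_s _ _ 0) rfl (Nat.zero_le _))))
      simp [euclid, Int.emod_def, mul_comm])
    (by rw [h_eq]; exact lt_irrefl 0)
  rwa [h_eq] at h_while

theorem num_den_eq_ediv_gcd {N D : ℤ} (hD : 0 < D) {f : ℚ} (hf : (N : ℚ) = D * f) :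
    f.num = N / Int.gcd D N ∧ (f.den : ℤ) = D / Int.gcd D N := by
  have h_divInt : f = Rat.divInt N D := by
    rw [Rat.divInt_eq_div, hf, mul_div_cancel_left₀ _ (by exact_mod_cast hD.ne')]
  constructor
  · rw [h_divInt, Rat.num_divInt, Int.sign_eq_one_of_pos hD, one_mul]
  · rw [h_divInt, Rat.den_divInt, if_neg hD.ne', Int.natCast_div, Int.natCast_natAbs,
      abs_of_pos hD]

/-- Writes the fraction `e₁ / e₂` in lowest terms. -/
def Prog.outRat (e₁ e₂ : Expr) : Prog :=
  .seq (.assign 11 e₁) (.seq (.assign 12 e₂) (.seq (.assign 13 .y) (.seq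
    (.assign 14 (.x - .x / .y * .y)) (.seq .gcd (.seq (.write (.x / .u)) (.seq (.write (.y / .u))
      (.seq (.assign 11 0) (.seq (.assign 12 0) (.assign 13 0)))))))))

theorem Exec.outRat {e₁ e₂ : Expr} {i N D : ℤ} (h₁ : e₁.eval (r.state { i }) = N)
    (h₂ : e₂.eval (r.state { i, x := N }) = D) (hD : 0 < D) (hNb : N.natAbs ≤ B.bound)
    (hDb : D.natAbs ≤ B.bound) {f : ℚ} (hf : (N : ℚ) = D * f) :
    Exec B (.outRat e₁ e₂) (r.state { i })
      ({ r with out := r.out ++ [f.num, (f.den : ℤ)] }.state { i }) := by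
  obtain ⟨h_num, h_den⟩ := num_den_eq_ediv_gcd hD hf
  lift D to ℕ using hD.le
  obtain ⟨v, hv⟩ := Int.eq_ofNat_of_zero_le (Int.emod_nonneg N hD.ne')
  have hvD : v < D := by have := Int.emod_lt_of_pos N hD; omega
  have h_gcd : Nat.gcd D v = Int.gcd D N := by
    rw [Int.gcd_comm (D : ℤ), ← Int.gcd_emod, hv, Int.gcd_comm]
    exact (Int.gcd_natCast_natCast D v).symm
  have h_euclid := Exec.gcd (B := B) (r := r) (t := { i, x := N, y := D }) hvD.le hDb
  rw [h_gcd] at h_euclid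
  rw [← List.singleton_append, ← List.append_assoc]
  refine .seq (.set (Regs.set_x _ _ _) h₁ hNb) (.seq (.set (Regs.set_y _ _ _) h₂ hDb)
    (.seq (.set (Regs.set_u _ _ (D : ℤ)) rfl hDb) (.seq (.set (Regs.set_v _ _ (v : ℤ)) ?_
      (hvD.le.trans hDb)) (h_euclid.seq (.seq (.emit h_num.symm) (.seq (.emit h_den.symm)
        (.seq (.set (Regs.set_x _ _ 0) rfl (Nat.zero_le _)) (.seq (.set (Regs.set_y _ _ 0) rfl
          (Nat.zero_le _)) (.set (Regs.set_u _ _ 0) rfl (Nat.zero_le _))))))))))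
  rw [← hv, Int.emod_def, mul_comm]
  rfl

theorem encRats_append (l l' : List ℚ) : encRats (l ++ l') = encRats l ++ encRats l' :=
  List.flatMap_append

/-- Writes the fractions `e₁ / e₂`, for `i` from `0` to `N - 1`, in lowest terms. -/
def Prog.outRats (N e₁ e₂ : Expr) : Prog := .loop 8 N (.outRat e₁ e₂)

theorem Exec.outRats {N e₁ e₂ : Expr} {n : ℕ} (hn : n ≤ B.passes) {num den : ℕ → ℤ}
    {f : Fin n → ℚ} (hN : ∀ out i, N.eval ({ r with out }.state { i }) = n)
    (h₁ : ∀ k < n, ∀ out, e₁.eval ({ r with out }.state { i := k }) = num k)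
    (h₂ : ∀ k < n, ∀ out x, e₂.eval ({ r with out }.state { i := k, x }) = den k)
    (h_den : ∀ k < n, 0 < den k)
    (hb : ∀ k < n, (num k).natAbs ≤ B.bound ∧ (den k).natAbs ≤ B.bound)
    (hf : ∀ k : Fin n, (num k : ℚ) = den k * f k) :
    Exec B (.outRats N e₁ e₂) r.state { r with out := r.out ++ encRats (List.ofFn f) }.state := by
  let q (k : ℕ) : ℚ := num k / den k
  have h_ne (k) (hk : k < n) : (den k : ℚ) ≠ 0 := Int.cast_ne_zero.2 (h_den k hk).ne'
  have h_list : List.ofFn f = (List.range n).map q := by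
    refine List.ext_getElem (by rw [List.length_ofFn, List.length_map, List.length_range])
      fun k hk _ => ?_
    rw [List.length_ofFn] at hk
    rw [List.getElem_ofFn, List.getElem_map, List.getElem_range]
    exact eq_div_of_mul_eq (h_ne k hk) (by rw [mul_comm, hf ⟨k, hk⟩])
  have h_loop := Exec.for_i (fun k => { r with out := r.out ++ encRats ((List.range k).map q) })
    (t := {}) rfl hn (N := N) (fun k _ => hN _ _) (p := .outRat e₁ e₂) fun k hk => by
      have h_step := Exec.outRat (B := B) (r := { r with
        out := r.out ++ encRats ((List.range k).map q) }) (h₁ k hk _) (h₂ k hk _ _) (h_den k hk)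
        (hb k hk).1 (hb k hk).2 (mul_div_cancel₀ _ (h_ne k hk)).symm
      rw [List.append_assoc] at h_step
      rw [List.range_succ, List.map_append, encRats_append]
      exact h_step
  rw [h_list]
  rwa [List.range_zero, List.map_nil, encRats, List.flatMap_nil, List.append_nil] at h_loop

/-! ## Input words -/

/-- The letters at `p` and `p + 1` are the numerator and the denominator of `q`. -/
structure FracAt (ws : List ℤ) (p : ℕ) (q : ℚ) : Prop where
  num : ws.getD p 0 = q.num
  den : ws.getD (p + 1) 0 = q.den
  lt : p + 1 < ws.length

theorem fracAt_encRats (u v : List ℤ) (l : List ℚ) {i : ℕ} (hi : i < l.length) :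
    FracAt (u ++ encRats l ++ v) (u.length + 2 * i) l[i] := by
  have h_split : u ++ encRats l ++ v = (u ++ encRats (l.take i)) ++
      (l[i].num :: (l[i].den : ℤ) :: (encRats (l.drop (i + 1)) ++ v)) := by
    conv_lhs => rw [← List.take_append_drop i l, List.drop_eq_getElem_cons hi, encRats_append]
    simp only [encRats, List.flatMap_cons, List.append_assoc, List.cons_append, List.nil_append]
  have h_length : (u ++ encRats (l.take i)).length = u.length + 2 * i := by
    rw [List.length_append, length_encRats, List.length_take, min_eq_left hi.le]
  rw [h_split, ← h_length]
  refine ⟨?_, ?_, ?_⟩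
  · rw [List.getD_append_right _ _ _ _ le_rfl, Nat.sub_self, List.getD_cons_zero]
  · rw [List.getD_append_right _ _ _ _ (Nat.le_add_right _ 1), Nat.add_sub_cancel_left,
      List.getD_cons_succ, List.getD_cons_zero]
  · simp only [List.length_append, List.length_cons]
    omega

theorem divNat_modNat_eq {m n : ℕ} {k : Fin (m * n)} {i : Fin m} {j : Fin n}
    (hk : (k : ℕ) = i * n + j) : (k.divNat, k.modNat) = (i, j) :=
  finProdFinEquiv.symm_apply_eq.2 (Fin.ext (by rw [hk, finProdFinEquiv_apply_val]; ring))

/-- The entries of a matrix row by row, followed by those of a vector. -/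
def entries {m n : ℕ} (D : Matrix (Fin m) (Fin n) ℚ) (s : Fin m → ℚ) : List ℚ :=
  List.ofFn (fun k : Fin (m * n) => D k.divNat k.modNat) ++ List.ofFn s

section

variable {m n : ℕ} (D : Matrix (Fin m) (Fin n) ℚ) (s : Fin m → ℚ)

theorem length_entries : (entries D s).length = m * n + m := by
  rw [entries, List.length_append, List.length_ofFn, List.length_ofFn]

theorem getElem_entries_mat (i : Fin m) (j : Fin n) (h : i * n + j < (entries D s).length) :
    (entries D s)[i * n + j] = D i j := by
  have h_lt : i * n + j < m * n := by nlinarith [i.2, j.2]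
  obtain ⟨h_div, h_mod⟩ := Prod.ext_iff.1 (divNat_modNat_eq (k := ⟨_, h_lt⟩) (i := i) rfl)
  simp only [entries]
  rw [List.getElem_append_left (by rwa [List.length_ofFn]), List.getElem_ofFn]
  exact congrArg₂ D h_div h_mod

theorem getElem_entries_vec (i : Fin m) (h : m * n + i < (entries D s).length) :
    (entries D s)[m * n + i] = s i := by
  simp only [entries]
  rw [List.getElem_append_right (by rw [List.length_ofFn]; omega), List.getElem_ofFn]
  congr 1
  ext
  simp only [List.length_ofFn, Nat.add_sub_cancel_left]

theorem encSystem_eq : encSystem D s =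
    ((m : ℤ) :: (n : ℤ) :: List.replicate (m + n) 0) ++ encRats (entries D s) := by
  have h_flatten : (List.ofFn fun i => List.ofFn fun j => D i j).flatten =
      List.ofFn fun k : Fin (m * n) => D k.divNat k.modNat := by
    rw [List.ofFn_mul]
    congr 2
    funext i
    congr 1
    funext j
    obtain ⟨h_div, h_mod⟩ := Prod.ext_iff.1 (divNat_modNat_eq (k := ⟨i * n + j, by
      nlinarith [i.2, j.2]⟩) (i := i) rfl)
    exact (congrArg₂ D h_div h_mod).symm
  rw [encSystem, encMat, h_flatten, entries, encRats_append]
  simp only [List.append_assoc, List.cons_append]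

theorem length_encSystem : (encSystem D s).length = 2 + m + n + 2 * (m * n + m) := by
  rw [encSystem_eq, List.length_append, length_encRats, length_entries]
  simp only [List.length_cons, List.length_replicate]
  ring

/-- The word `ws` contains the code of `⟨D, s⟩` at address `o`. -/
structure SystemAt (ws : List ℤ) (o : ℕ) : Prop where
  rows : ws.getD o 0 = m
  cols : ws.getD (o + 1) 0 = n
  mat : ∀ (i : Fin m) (j : Fin n), FracAt ws (o + 2 + m + n + 2 * (i * n + j)) (D i j)
  vec : ∀ i : Fin m, FracAt ws (o + 2 + m + n + 2 * (m * n + i)) (s i)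
  le : o + 2 + m + n ≤ ws.length

theorem systemAt_append (u v : List ℤ) : SystemAt D s (u ++ encSystem D s ++ v) u.length := by
  have h_frac (k) (hk : k < (entries D s).length) :
      FracAt (u ++ encSystem D s ++ v) (u.length + 2 + m + n + 2 * k) (entries D s)[k] := by
    convert fracAt_encRats (u ++ ((m : ℤ) :: (n : ℤ) :: List.replicate (m + n) 0)) v _ hk using 1
    · rw [encSystem_eq, ← List.append_assoc u]
    · simp only [List.length_append, List.length_cons, List.length_replicate]
      omega
  refine ⟨?_, ?_, fun i j => ?_, fun i => ?_, ?_⟩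
  · rw [List.append_assoc, List.getD_append_right _ _ _ _ le_rfl, Nat.sub_self]
    rfl
  · rw [List.append_assoc, List.getD_append_right _ _ _ _ (Nat.le_add_right _ 1),
      Nat.add_sub_cancel_left]
    rfl
  · have h_lt : i * n + j < (entries D s).length := by
      rw [length_entries]
      nlinarith [i.2, j.2]
    rw [← getElem_entries_mat D s i j h_lt]
    exact h_frac _ h_lt
  · have h_lt : m * n + i < (entries D s).length := by
      rw [length_entries]
      omega
    rw [← getElem_entries_vec D s i h_lt]
    exact h_frac _ h_lt
  · rw [List.length_append, List.length_append, length_encSystem]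
    omega

theorem systemAt_encSystem : SystemAt D s (encSystem D s) 0 := by
  simpa only [List.nil_append, List.append_nil, List.length_nil] using systemAt_append D s [] []

theorem systemAt_encPair (v : List ℤ) : SystemAt D s (encPair (encSystem D s) v) 1 :=
  systemAt_append D s [((encSystem D s).length : ℤ)] v

/-- The word `ws` contains the entries of `x` from address `o` on. -/
def VecAt {k : ℕ} (x : Fin k → ℚ) (ws : List ℤ) (o : ℕ) : Prop :=
  ∀ i : Fin k, FracAt ws (o + 2 * i) (x i)

theorem vecAt_encPair {k : ℕ} (x : Fin k → ℚ) :
    VecAt x (encPair (encSystem D s) (encVec x)) (1 + 2 + m + n + 2 * (m * n + m) + 1) := by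
  intro i
  convert fracAt_encRats (((encSystem D s).length : ℤ) :: (encSystem D s ++ [(k : ℤ)])) []
    (List.ofFn x) (i := i) (by rw [List.length_ofFn]; exact i.2) using 1
  · simp [encPair, encVec]
  · simp only [List.length_cons, List.length_append, length_encSystem, List.length_nil]
    omega
  · rw [List.getElem_ofFn]

end

/-! ## Bounds -/

theorem sum_bitLen_getD (ws : List ℤ) :
    ∑ i ∈ Finset.range ws.length, bitLen (ws.getD i 0) = wordSize ws := by
  induction ws with
  | nil => rfl
  | cons z ws ih =>
    rw [List.length_cons, Finset.sum_range_succ']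
    simp only [List.getD_cons_succ, List.getD_cons_zero, ih]
    simp only [wordSize, List.map_cons, List.sum_cons, add_comm]

theorem sum_bitLen_getD_le {ws : List ℤ} {k : ℕ} (hk : k ≤ ws.length) :
    ∑ i ∈ Finset.range k, bitLen (ws.getD i 0) ≤ wordSize ws :=
  (Finset.sum_le_sum_of_subset (Finset.range_mono hk)).trans_eq (sum_bitLen_getD ws)

theorem length_le_wordSize (ws : List ℤ) : ws.length ≤ wordSize ws := by
  rw [wordSize, ← List.length_map (f := bitLen)]
  exact List.length_le_sum_of_one_le _ fun _ h => by
    obtain ⟨z, -, rfl⟩ := List.mem_map.1 h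
    rw [bitLen]
    omega

theorem natAbs_le_two_pow_bitLen (z : ℤ) : z.natAbs ≤ 2 ^ bitLen z :=
  (Nat.lt_size_self z.natAbs).le.trans
    (Nat.pow_le_pow_right two_pos (by rw [bitLen]; omega))

theorem natAbs_getD_le (ws : List ℤ) (i : ℕ) : (ws.getD i 0).natAbs ≤ 2 ^ wordSize ws := by
  by_cases hi : i < ws.length
  · refine (natAbs_le_two_pow_bitLen _).trans (Nat.pow_le_pow_right two_pos ?_)
    rw [← sum_bitLen_getD]
    exact Finset.single_le_sum (f := fun i => bitLen (ws.getD i 0)) (fun _ _ => Nat.zero_le _)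
      (Finset.mem_range.2 hi)
  · rw [List.getD_eq_default _ _ (not_lt.1 hi)]
    exact Nat.zero_le _

theorem natAbs_posProd_le (f : ℕ → ℤ) (k : ℕ) :
    (posProd f k).natAbs ≤ 2 ^ ∑ i ∈ Finset.range k, bitLen (f i) := by
  rw [posProd, ← Finset.prod_pow_eq_pow_sum, ← Int.natAbsHom_apply, map_prod]
  refine Finset.prod_le_prod' fun i _ => ?_
  rw [Int.natAbsHom_apply]
  split_ifs
  · exact natAbs_le_two_pow_bitLen _
  · exact Nat.one_le_two_pow

theorem posProd_pos (f : ℕ → ℤ) (k : ℕ) : 0 < posProd f k :=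
  Finset.prod_pos fun i _ => by split_ifs <;> omega

theorem dvd_posProd {f : ℕ → ℤ} {i k : ℕ} (hi : i < k) (h : 0 < f i) : f i ∣ posProd f k := by
  conv_lhs => rw [← if_pos (c := 0 < f i) (t := f i) (e := 1) h]
  exact Finset.dvd_prod_of_mem (fun i => if 0 < f i then f i else 1) (Finset.mem_range.2 hi)

/-- Bounds the numbers in an elimination on an input of size `W`. -/
def elimBound (W : ℕ) : ℕ := (2 ^ (3 * W + 1)) ^ (2 * W)

theorem le_elimBound {W c N : ℕ} (hc : c + 1 ≤ W) (hN : N ≤ W) :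
    ((c + 1) * 2 ^ (2 * W + 1)) ^ (2 * N) ≤ elimBound W := by
  have h_base : (c + 1) * 2 ^ (2 * W + 1) ≤ 2 ^ (3 * W + 1) :=
    calc (c + 1) * 2 ^ (2 * W + 1) ≤ 2 ^ W * 2 ^ (2 * W + 1) := by
          gcongr
          exact hc.trans Nat.lt_two_pow_self.le
      _ = 2 ^ (3 * W + 1) := by rw [← pow_add]; congr 1; ring
  exact (Nat.pow_le_pow_left h_base _).trans
    (Nat.pow_le_pow_right Nat.one_le_two_pow (Nat.mul_le_mul_left 2 hN))

theorem one_le_elimBound (W : ℕ) : 1 ≤ elimBound W := Nat.one_le_pow _ _ Nat.one_le_two_pow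

theorem elimBound_sq_mul (W : ℕ) :
    elimBound W ^ 2 * 2 ^ (3 * W + 3) = 2 ^ (12 * W ^ 2 + 7 * W + 3) := by
  rw [elimBound, ← pow_mul, ← pow_mul, ← pow_add]
  congr 1
  ring

/-- The limits for the programs below on an input of size `W`. -/
def limits (W : ℕ) : Limits where
  bound := elimBound W ^ 2 * 2 ^ (3 * W + 3)
  passes := 2 * (12 * W ^ 2 + 7 * W + 4)
  two_le_bound := by
    rw [elimBound_sq_mul]
    exact Nat.le_self_pow (by omega) 2
  passes_le_bound := by
    rw [elimBound_sq_mul]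
    generalize h : 12 * W ^ 2 + 7 * W = X
    rw [pow_add]
    have := Nat.lt_two_pow_self (n := X)
    omega
  two_mul_size_le := by
    rw [elimBound_sq_mul, Nat.size_pow]

theorem le_limits_passes {W k : ℕ} (h : k ≤ W) : k ≤ (limits W).passes := by
  simp only [limits]
  nlinarith

theorem add_le_limits_passes {W k l : ℕ} (hk : k ≤ W) (hl : l ≤ W) :
    k + l ≤ (limits W).passes := by
  simp only [limits]
  nlinarith

theorem mul_le_limits_passes {W k l : ℕ} (hk : k ≤ W) (hl : l ≤ W) :
    k * l ≤ (limits W).passes := by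
  simp only [limits]
  nlinarith [Nat.mul_le_mul hk hl]

theorem le_limits_bound {W k : ℕ} (h : k ≤ W) : k ≤ (limits W).bound :=
  (le_limits_passes h).trans (limits W).passes_le_bound

theorem elimBound_sq_mul_le {W k : ℕ} (hk : k ≤ 2 ^ (3 * W + 3)) :
    elimBound W ^ 2 * k ≤ (limits W).bound :=
  Nat.mul_le_mul_left _ hk

theorem elimBound_mul_le (W : ℕ) : elimBound W * 2 ^ (3 * W + 3) ≤ (limits W).bound :=
  Nat.mul_le_mul_right _ (Nat.le_self_pow two_ne_zero _)

theorem elimBound_le (W : ℕ) : elimBound W ≤ (limits W).bound :=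
  (Nat.le_mul_of_pos_right _ (by positivity)).trans (elimBound_mul_le W)

theorem two_pow_le_limits_bound {W k : ℕ} (h : k ≤ 3 * W + 3) : 2 ^ k ≤ (limits W).bound :=
  (Nat.pow_le_pow_right two_pos h).trans
    ((Nat.le_mul_of_pos_left _ (one_le_elimBound W)).trans (elimBound_mul_le W))

theorem bdd_init (ws : List ℤ) : (init ws).Bdd (limits (wordSize ws)).bound := by
  refine ⟨fun x => ?_, fun a i => ?_⟩
  · simp only [init]
    split_ifs
    · exact le_limits_bound (length_le_wordSize ws)
    · exact Nat.zero_le _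
  · simp only [init]
    split_ifs
    · exact (natAbs_getD_le _ _).trans (two_pow_le_limits_bound (by omega))
    · exact Nat.zero_le _

theorem polyTime_of_exec_limits {α : Type} {input output : α → List ℤ} (p : Prog)
    (h : ∀ a, ∃ σ, Exec (limits (wordSize (input a))) p (init (input a)) σ ∧ σ.out = output a) :
    PolyTime input output := by
  refine polyTime_of_exec p (24 * Polynomial.X ^ 2 + 14 * Polynomial.X + 8) fun a =>
    ⟨_, ?_, ?_, bdd_init _, h a⟩
  · simp only [limits, elimBound_sq_mul, Nat.size_pow, Polynomial.eval_add, Polynomial.eval_mul,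
      Polynomial.eval_pow, Polynomial.eval_X, Polynomial.eval_ofNat]
    omega
  · simp only [limits, Polynomial.eval_add, Polynomial.eval_mul, Polynomial.eval_pow,
      Polynomial.eval_X, Polynomial.eval_ofNat]
    omega

/-! ## Reading the input -/

/-- The initial contents of the registers on the input word `ws`. -/
def Regs.init (ws : List ℤ) : Regs where
  len := ws.length
  inp i := if 0 ≤ i then ws.getD i.toNat 0 else 0

theorem init_eq (ws : List ℤ) : init ws = (Regs.init ws).state := by
  have h_var : (init ws).var = (Regs.init ws).varAt {} := by
    funext x
    unfold Regs.varAt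
    split <;> first | rfl | exact if_neg (by assumption)
  have h_arr : (init ws).arr = (Regs.init ws).arrAt := by
    funext a i
    unfold Regs.arrAt
    split <;> simp_all [init, Regs.init]
  rw [Regs.state, ← h_var, ← h_arr]
  rfl

variable {m n : ℕ} {D : Matrix (Fin m) (Fin n) ℚ} {s : Fin m → ℚ} {ws : List ℤ} {o : ℕ}

/-- The registers `r` hold the dimensions of the system `⟨D, s⟩`, encoded at address `o` of the
input `ws`, and the fractions of the input, scaled by a common denominator `L`, in the array `S`. -/
structure Loaded (D : Matrix (Fin m) (Fin n) ℚ) (s : Fin m → ℚ) (ws : List ℤ) (o : ℕ)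
    (r : Regs) : Prop extends SystemAt D s ws o where
  k_eq : r.k = 0
  m_eq : r.m = m
  n_eq : r.n = n
  b_eq : r.b = (o + 2 + m + n : ℕ)
  L_pos : 0 < r.L
  L_le : r.L.natAbs ≤ 2 ^ wordSize ws
  S_eq : ∀ p q, FracAt ws p q → (r.S p : ℚ) = r.L * q
  S_le : ∀ p q, FracAt ws p q → (r.S p).natAbs ≤ 2 ^ (2 * wordSize ws)
  out_eq : r.out = []

/-- The letters of `ws`, as numerators followed by their denominators, scaled by `L`. -/
def scaled (ws : List ℤ) (L : ℤ) (k : ℕ) : ℤ := ws.getD k 0 * (L / ws.getD (k + 1) 0)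

/-- The product of the positive letters of `ws`. -/
def commonDen (ws : List ℤ) : ℤ := posProd (fun i => ws.getD i 0) ws.length

theorem natAbs_commonDen_le (ws : List ℤ) : (commonDen ws).natAbs ≤ 2 ^ wordSize ws := by
  rw [← sum_bitLen_getD]
  exact natAbs_posProd_le _ _

theorem natAbs_scaled_le (ws : List ℤ) (k : ℕ) :
    (scaled ws (commonDen ws) k).natAbs ≤ 2 ^ (2 * wordSize ws) := by
  rw [scaled, Int.natAbs_mul, two_mul, pow_add]
  exact Nat.mul_le_mul (natAbs_getD_le _ _)
    ((Int.natAbs_ediv_le_natAbs _ _).trans (natAbs_commonDen_le ws))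

theorem FracAt.scaled_eq {p : ℕ} {q : ℚ} (h : FracAt ws p q) :
    (scaled ws (commonDen ws) p : ℚ) = commonDen ws * q := by
  have h_pos : 0 < ws.getD (p + 1) 0 := by
    rw [h.den]
    exact_mod_cast q.den_pos
  obtain ⟨z, hz⟩ : ws.getD (p + 1) 0 ∣ commonDen ws :=
    dvd_posProd (f := fun i => ws.getD i 0) h.lt h_pos
  rw [scaled, hz, Int.mul_ediv_cancel_left _ h_pos.ne', h.num, h.den]
  push_cast
  rw [← Rat.mul_den_eq_num]
  ring

/-- Reads the system encoded at address `o` of the input. -/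
def Prog.read (o : Expr) : Prog :=
  .seq (.assign 2 (.inp o)) (.seq (.assign 3 (.inp (o + 1))) (.seq (.assign 6 (o + 2 + .m + .n))
    (.seq .posProd .scale)))

theorem SystemAt.exists_loaded (h : SystemAt D s ws o) {e : Expr} (he : ∀ σ, e.eval σ = o) :
    ∃ r, Exec (limits (wordSize ws)) (.read e) (init ws) r.state ∧ Loaded D s ws o r := by
  have h_len := length_le_wordSize ws
  have h_addr := h.le
  have h_inp (k : ℕ) : (Regs.init ws).inp k = ws.getD k 0 := by simp [Regs.init]
  have h_inp_succ (k : ℕ) : (Regs.init ws).inp (k + 1) = ws.getD (k + 1) 0 := h_inp (k + 1)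
  let r : Regs := { Regs.init ws with m := m, n := n, b := (o + 2 + m + n : ℕ) }
  have h_prod := Exec.posProd (B := limits (wordSize ws)) (r := r) (le_limits_passes h_len) rfl
    fun k hk => (natAbs_posProd_le _ _).trans (two_pow_le_limits_bound (by
      simp only [r, h_inp]
      exact (sum_bitLen_getD_le hk).trans (by omega)))
  have h_scale := Exec.scale (B := limits (wordSize ws)) (r := { r with L := commonDen ws })
    (le_limits_passes h_len) rfl fun k _ => by
      simp only [r, h_inp, h_inp_succ]
      exact (natAbs_scaled_le ws k).trans (two_pow_le_limits_bound (by omega))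
  simp only [r, h_inp, h_inp_succ] at h_prod h_scale
  have h_S {p q} (hpq : FracAt ws p q) :
      fill ws.length (scaled ws (commonDen ws)) 0 p = scaled ws (commonDen ws) p :=
    fill_natCast _ _ (Nat.lt_of_succ_lt hpq.lt)
  refine ⟨{ r with L := commonDen ws, S := fill ws.length (scaled ws (commonDen ws)) 0 }, ?_,
    { h with
      k_eq := rfl, m_eq := rfl, n_eq := rfl, b_eq := rfl, L_pos := posProd_pos _ _
      L_le := natAbs_commonDen_le ws, out_eq := rfl
      S_eq := fun p q hpq => (congrArg Int.cast (h_S hpq)).trans hpq.scaled_eq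
      S_le := fun p q hpq => (congrArg Int.natAbs (h_S hpq)).trans_le (natAbs_scaled_le ws p) }⟩
  rw [init_eq]
  refine .seq (.set (Regs.set_m _ _ (m : ℤ)) ?_ (le_limits_bound (by omega)))
    (.seq (.set (Regs.set_n _ _ (n : ℤ)) ?_ (le_limits_bound (by omega)))
      (.seq (.set (Regs.set_b _ _ ((o + 2 + m + n : ℕ) : ℤ)) ?_ (le_limits_bound (by omega)))
        (h_prod.seq h_scale)))
  · rw [Regs.eval_get, he]
    exact (h_inp o).trans h.rows
  · rw [Regs.eval_get, Expr.eval_add, he]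
    exact (h_inp_succ o).trans h.cols
  · rw [Expr.eval_add, Expr.eval_add, Expr.eval_add, he, Nat.cast_add, Nat.cast_add, Nat.cast_add]
    rfl

/-- The entry of the matrix in the input, scaled by `L`. -/
abbrev Expr.matEntry (i j : Expr) : Expr := .S (.b + 2 * (i * .n + j))

/-- The entry of the right-hand side in the input, scaled by `L`. -/
abbrev Expr.vecEntry (i : Expr) : Expr := .S (.b + 2 * (.m * .n + i))

/-- The entry of the vector that follows the system in the input, scaled by `L`. -/
abbrev Expr.solEntry (i : Expr) : Expr := .S (.b + 2 * (.m * .n + .m) + 1 + 2 * i)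

namespace Loaded

variable (h : Loaded D s ws o r)
include h

theorem S_mat (i : Fin m) (j : Fin n) :
    (r.S (r.b + 2 * ((i : ℕ) * r.n + (j : ℕ))) : ℚ) = r.L * D i j ∧
      (r.S (r.b + 2 * ((i : ℕ) * r.n + (j : ℕ)))).natAbs ≤ 2 ^ (2 * wordSize ws) := by
  rw [h.b_eq, h.n_eq]
  exact ⟨h.S_eq _ _ (h.mat i j), h.S_le _ _ (h.mat i j)⟩

theorem S_vec (i : Fin m) :
    (r.S (r.b + 2 * (r.m * r.n + (i : ℕ))) : ℚ) = r.L * s i ∧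
      (r.S (r.b + 2 * (r.m * r.n + (i : ℕ)))).natAbs ≤ 2 ^ (2 * wordSize ws) := by
  rw [h.b_eq, h.n_eq, h.m_eq]
  exact ⟨h.S_eq _ _ (h.vec i), h.S_le _ _ (h.vec i)⟩

theorem S_sol {k : ℕ} {x : Fin k → ℚ}
    (hx : VecAt x ws (o + 2 + m + n + 2 * (m * n + m) + 1)) (i : Fin k) :
    (r.S (r.b + 2 * (r.m * r.n + r.m) + 1 + 2 * (i : ℕ)) : ℚ) = r.L * x i ∧
      (r.S (r.b + 2 * (r.m * r.n + r.m) + 1 + 2 * (i : ℕ))).natAbs ≤ 2 ^ (2 * wordSize ws) := by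
  rw [h.b_eq, h.n_eq, h.m_eq]
  exact ⟨h.S_eq _ _ (hx i), h.S_le _ _ (hx i)⟩

theorem add_le_wordSize : m + n + 2 ≤ wordSize ws := by
  have h_addr := h.le
  have h_len := length_le_wordSize ws
  omega

end Loaded

/-! ## Output -/

/-- Writes the code of the vector of length `N` with the numerators `e₁` and the common
denominator `e₂`. -/
def Prog.outVec (N e₁ e₂ : Expr) : Prog := .seq (.write N) (.outRats N e₁ e₂)

theorem Exec.outVec {N e₁ e₂ : Expr} (h_out : r.out = []) (hn : n ≤ B.passes) {num : ℕ → ℤ}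
    {den : ℤ} {f : Fin n → ℚ} (hN : ∀ out i, N.eval ({ r with out }.state { i }) = n)
    (h₁ : ∀ k < n, ∀ out, e₁.eval ({ r with out }.state { i := k }) = num k)
    (h₂ : ∀ k < n, ∀ out x, e₂.eval ({ r with out }.state { i := k, x }) = den)
    (h_den : 0 < den) (h_num_le : ∀ k < n, (num k).natAbs ≤ B.bound)
    (h_den_le : den.natAbs ≤ B.bound) (hf : ∀ k : Fin n, (num k : ℚ) = den * f k) :
    Exec B (.outVec N e₁ e₂) r.state { r with out := encVec f }.state := by
  have h_rats := Exec.outRats (r := { r with out := r.out ++ [(n : ℤ)] }) hn hN h₁ h₂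
    (fun _ _ => h_den) (fun k hk => ⟨h_num_le k hk, h_den_le⟩) hf
  rw [h_out] at h_rats
  exact .seq (.emit (hN _ _)) (by rw [h_out]; exact h_rats)

/-- Writes the code of the square system of size `N` whose matrix has the numerators `e₁` and the
common denominator `e₂`, and whose right-hand side has the numerators `e₃` and the common
denominator `e₄`. -/
def Prog.outSystem (N e₁ e₂ e₃ e₄ : Expr) : Prog :=
  .seq (.write N) (.seq (.write N) (.seq (.loop 8 (N + N) (.write 0))
    (.seq (.outRats (N * N) e₁ e₂) (.outRats N e₃ e₄))))

theorem Exec.outSystem {N e₁ e₂ e₃ e₄ : Expr} (h_out : r.out = []) (hn : n + n ≤ B.passes)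
    (hnn : n * n ≤ B.passes) {numA : ℕ → ℕ → ℤ} {numY : ℕ → ℤ} {denA denY : ℤ}
    {A : Matrix (Fin n) (Fin n) ℚ} {y : Fin n → ℚ}
    (hN : ∀ out i, N.eval ({ r with out }.state { i }) = n)
    (h₁ : ∀ k < n * n, ∀ out, e₁.eval ({ r with out }.state { i := k }) = numA (k / n) (k % n))
    (h₂ : ∀ k < n * n, ∀ out x, e₂.eval ({ r with out }.state { i := k, x }) = denA)
    (h₃ : ∀ k < n, ∀ out, e₃.eval ({ r with out }.state { i := k }) = numY k)
    (h₄ : ∀ k < n, ∀ out x, e₄.eval ({ r with out }.state { i := k, x }) = denY)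
    (h_denA : 0 < denA) (h_denY : 0 < denY)
    (h_numA_le : ∀ i < n, ∀ j < n, (numA i j).natAbs ≤ B.bound)
    (h_denA_le : denA.natAbs ≤ B.bound)
    (h_numY_le : ∀ k < n, (numY k).natAbs ≤ B.bound) (h_denY_le : denY.natAbs ≤ B.bound)
    (hA : ∀ i j : Fin n, (numA i j : ℚ) = denA * A i j)
    (hy : ∀ k : Fin n, (numY k : ℚ) = denY * y k) :
    Exec B (.outSystem N e₁ e₂ e₃ e₄) r.state { r with out := encSystem A y }.state := by
  have h_zeros := Exec.for_i (B := B) (t := {}) (N := N + N) (p := .write 0)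
    (fun k => { r with out := [(n : ℤ), (n : ℤ)] ++ List.replicate k 0 }) rfl hn
    (fun k _ => by rw [Expr.eval_add, hN, Nat.cast_add]) fun k _ => by
      rw [List.replicate_succ', ← List.append_assoc]
      exact .emit rfl
  have h_mod {k} (hk : k < n * n) : k % n < n :=
    Nat.mod_lt _ (Nat.pos_of_mul_pos_left (by omega : 0 < n * n))
  have h_mat := Exec.outRats (N := N * N)
    (r := { r with out := [(n : ℤ), (n : ℤ)] ++ List.replicate (n + n) 0 }) hnn
    (f := fun k : Fin (n * n) => A k.divNat k.modNat)
    (fun out i => by rw [Expr.eval_mul, hN, Nat.cast_mul]) h₁ h₂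
    (fun _ _ => h_denA)
    (fun k hk => ⟨h_numA_le _ (Nat.div_lt_of_lt_mul hk) _ (h_mod hk), h_denA_le⟩)
    fun k => hA k.divNat k.modNat
  have h_vec := Exec.outRats (N := N) (r := { r with
      out := ([(n : ℤ), (n : ℤ)] ++ List.replicate (n + n) 0) ++ encRats (List.ofFn
        fun k : Fin (n * n) => A k.divNat k.modNat) })
    (by omega) hN h₃ h₄ (fun _ _ => h_denY) (fun k hk => ⟨h_numY_le k hk, h_denY_le⟩) hy
  have h_code : encSystem A y = ([(n : ℤ), (n : ℤ)] ++ List.replicate (n + n) 0) ++ encRats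
      (List.ofFn fun k : Fin (n * n) => A k.divNat k.modNat) ++ encRats (List.ofFn y) := by
    rw [encSystem_eq, entries, encRats_append, ← List.append_assoc]
    rfl
  have h_body := h_zeros.seq (h_mat.seq h_vec)
  rw [← h_code] at h_body
  refine .seq (.emit (hN _ 0)) (.seq (.emit (hN _ 0)) ?_)
  rw [h_out]
  exact h_body

end RAM

section

variable {c n m : ℕ}

namespace FracMatrix

variable (F : FracMatrix) (n : ℕ)

/-- The numerators of the Schur complement of the entry with indices `n`, `n`; the denominator is
`F.den * F.num n n`. -/
def schurNum (i j : ℕ) : ℤ := F.num n n * F.num i j - F.num i n * F.num j n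

/-- The numerators of the solution that arises from `particular D s` by subtracting the projection
of a vector `x` onto the null space of `D`; the denominator is `F.den * l * F.num n n`. Here `w`
contains the product of `F.num` and the numerators of `x`, with the denominator `l`. -/
def solNum (l : ℤ) (w : ℕ → ℤ) (i : ℕ) : ℤ :=
  -(F.num i n * (F.den * l - w n) + F.num n n * w i)

end FracMatrix

/-- The numerators and the denominator of `F` represent the matrix `P`, and are at most `D`. -/
structure FracMatrix.Represents (F : FracMatrix) (P : Matrix (Fin c) (Fin c) ℚ) (D : ℕ) :
    Prop where
  den_pos : 0 < F.den
  den_le : F.den.natAbs ≤ D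
  num_le : ∀ i < c, ∀ j < c, (F.num i j).natAbs ≤ D
  num_eq : ∀ i j : Fin c, (F.num i j : ℚ) = F.den * P i j

namespace FracMatrix.Represents

theorem numMulVec_eq {F : FracMatrix} {P : Matrix (Fin c) (Fin c) ℚ} {E : ℕ}
    (h : F.Represents P E) {f : ℕ → ℤ} {l : ℚ} {x : Fin c → ℚ}
    (hf : ∀ j : Fin c, (f j : ℚ) = l * x j) (i : Fin c) :
    (F.numMulVec c f i : ℚ) = F.den * l * (P *ᵥ x) i := by
  rw [FracMatrix.numMulVec, dotN_eq_dotProduct, dotProduct, Matrix.mulVec, dotProduct,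
    Int.cast_sum, Finset.mul_sum]
  refine Finset.sum_congr rfl fun j _ => ?_
  rw [Int.cast_mul, h.num_eq, hf]
  ring

section

variable {F : FracMatrix} {P : Matrix (Fin (n + 1)) (Fin (n + 1)) ℚ} {E : ℕ} (h : F.Represents P E)
include h

theorem natAbs_num_le {i j : ℕ} (hi : i ≤ n) (hj : j ≤ n) : (F.num i j).natAbs ≤ E :=
  h.num_le i (Nat.lt_succ_of_le hi) j (Nat.lt_succ_of_le hj)

theorem natAbs_num_mul_num_le {i j k l : ℕ} (hi : i ≤ n) (hj : j ≤ n) (hk : k ≤ n) (hl : l ≤ n) :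
    (F.num i j * F.num k l).natAbs ≤ E ^ 2 := by
  rw [Int.natAbs_mul, sq]
  exact Nat.mul_le_mul (h.natAbs_num_le hi hj) (h.natAbs_num_le hk hl)

theorem natAbs_den_mul_num_le : (F.den * F.num n n).natAbs ≤ E ^ 2 := by
  rw [Int.natAbs_mul, sq]
  exact Nat.mul_le_mul h.den_le (h.natAbs_num_le le_rfl le_rfl)

theorem natAbs_schurNum_le {i j : ℕ} (hi : i ≤ n) (hj : j ≤ n) :
    (F.schurNum n i j).natAbs ≤ E ^ 2 * 2 := by
  rw [Nat.mul_two]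
  exact (Int.natAbs_sub_le _ _).trans (Nat.add_le_add
    (h.natAbs_num_mul_num_le le_rfl le_rfl hi hj) (h.natAbs_num_mul_num_le hi le_rfl hj le_rfl))

theorem natAbs_solNum_le {l : ℤ} {w : ℕ → ℤ} {K : ℕ} (hl : l.natAbs ≤ K)
    (hw : ∀ i ≤ n, (w i).natAbs ≤ E * K) {i : ℕ} (hi : i ≤ n) :
    (F.solNum n l w i).natAbs ≤ E ^ 2 * (3 * K) := by
  have h_mul {a b : ℤ} {B : ℕ} (ha : a.natAbs ≤ E) (hb : b.natAbs ≤ B) :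
      (a * b).natAbs ≤ E * B := (Int.natAbs_mul a b).trans_le (Nat.mul_le_mul ha hb)
  calc (F.solNum n l w i).natAbs
      ≤ (F.num i n * (F.den * l - w n)).natAbs + (F.num n n * w i).natAbs :=
        (Int.natAbs_neg _).trans_le (Int.natAbs_add_le _ _)
    _ ≤ E * (E * K + E * K) + E * (E * K) := Nat.add_le_add
        (h_mul (h.natAbs_num_le hi le_rfl) ((Int.natAbs_sub_le _ _).trans
          (Nat.add_le_add (h_mul h.den_le hl) (hw n le_rfl))))
        (h_mul (h.natAbs_num_le le_rfl le_rfl) (hw i hi))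
    _ = E ^ 2 * (3 * K) := by ring

end

variable {F : FracMatrix} {D : Matrix (Fin m) (Fin n) ℚ} {s : Fin m → ℚ} {E : ℕ}
  (h : F.Represents (nullProj (augment D s)) E) (hs : ∃ v, D *ᵥ v = s)
include h

theorem num_last_eq : (F.num n n : ℚ) =
    F.den * nullProj (augment D s) (Fin.last n) (Fin.last n) :=
  h.num_eq (Fin.last n) (Fin.last n)

theorem num_castSucc_last_eq (i : Fin n) : (F.num i n : ℚ) =
    F.den * nullProj (augment D s) i.castSucc (Fin.last n) :=
  h.num_eq i.castSucc (Fin.last n)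

include hs

theorem num_last_pos : 0 < F.num n n := by
  rw [← Int.cast_pos (R := ℚ), h.num_last_eq]
  exact mul_pos (Int.cast_pos.2 h.den_pos) (nullProj_augment_last_pos hs)

theorem neg_num_eq (i : Fin n) :
    ((-F.num i n : ℤ) : ℚ) = F.num n n * particular D s i := by
  have h_last := (nullProj_augment_last_pos hs).ne'
  rw [Int.cast_neg, h.num_castSucc_last_eq, h.num_last_eq, particular]
  field_simp

theorem schurNum_eq (i j : Fin n) :
    (F.schurNum n i j : ℚ) =
      (F.den * F.num n n : ℤ) * nullProj D i j := by
  have h_last := (nullProj_augment_last_pos hs).ne'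
  have h_ij : (F.num i j : ℚ) = F.den * nullProj (augment D s) i.castSucc j.castSucc :=
    h.num_eq i.castSucc j.castSucc
  rw [FracMatrix.schurNum, nullProj_eq_nullProj_augment h_last]
  push_cast
  rw [h_ij, h.num_castSucc_last_eq, h.num_castSucc_last_eq, h.num_last_eq]
  field_simp

theorem solNum_eq {w : ℕ → ℤ} {l : ℤ} {x : Fin n → ℚ}
    (hw : ∀ i : Fin (n + 1),
      (w i : ℚ) = F.den * l * (nullProj (augment D s) *ᵥ (Fin.snoc x 0 : Fin (n + 1) → ℚ)) i)
    (i : Fin n) :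
    (F.solNum n l w i : ℚ) =
      (F.den * l * F.num n n : ℤ) * (particular D s - nullProj D *ᵥ x) i := by
  have h_last := (nullProj_augment_last_pos hs).ne'
  have hwn := hw (Fin.last n)
  have hwi := hw i.castSucc
  rw [Fin.val_last] at hwn
  rw [Fin.val_castSucc] at hwi
  rw [FracMatrix.solNum, Pi.sub_apply, nullProj_mulVec_eq h_last, particular]
  push_cast
  rw [hwn, hwi, h.num_castSucc_last_eq, h.num_last_eq]
  field_simp
  ring

end FracMatrix.Represents

end

namespace RAM

/-! ## Projections onto null spaces -/

section

variable {r : Regs} {W c n : ℕ}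

theorem Exec.nullProj {A : Matrix (Fin n) (Fin c) ℚ} {N C e : Expr} (hk : r.k = 0) (hc : c + 1 ≤ W)
    (hn : n ≤ W) {l : ℚ} (hl : l ≠ 0) {R : ℕ → ℕ → ℤ}
    (hR : ∀ (i : Fin n) (j : Fin c), (R i j : ℚ) = l * A i j ∧ (R i j).natAbs ≤ 2 ^ (2 * W + 1))
    (hC : C.eval r.state = c) (hN : ∀ a Q d w k t, N.eval ({ r with c, a, Q, d, w, k }.state t) = n)
    (he : ∀ k < n * c, ∀ a, e.eval ({ r with c, a }.state { i := k }) = R (k / c) (k % c)) :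
    ∃ F a w, Exec (limits W) (.project N C e) r.state ({ r with c, a, w }.withProj c F).state ∧
      F.Represents (nullProj A) (elimBound W) := by
  have hc' : c ≤ W := Nat.le_of_succ_le hc
  have h_le : ∀ i < n, ∀ j < c, (R i j).natAbs ≤ 2 ^ (2 * W + 1) :=
    fun i hi j hj => (hR ⟨i, hi⟩ ⟨j, hj⟩).2
  obtain ⟨a, w, h_exec⟩ := Exec.project hk (mul_le_limits_passes hc' hc')
    (mul_le_limits_passes hn hc') (le_limits_passes hn) Nat.one_le_two_pow h_le
    (two_pow_le_limits_bound (by omega))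
    ((le_elimBound hc hn).trans (elimBound_le W)) hC hN he
  have h_den : (FracMatrix.elim c R n).den.natAbs ≤ elimBound W :=
    (FracMatrix.natAbs_elim_den_le Nat.one_le_two_pow h_le le_rfl).trans (le_elimBound hc hn)
  exact ⟨_, a, w, h_exec, FracMatrix.elim_den_pos c R n, h_den,
    fun i hi j hj => (FracMatrix.natAbs_elim_num_le n hi hj).trans h_den,
    FracMatrix.elim_num_eq hl fun i j => (hR i j).1⟩

end

/-- The registers `r` hold the projection `P`, of size `c`, as the fractions `F`. -/
structure Projected {c : ℕ} (P : Matrix (Fin c) (Fin c) ℚ) (ws : List ℤ) (F : FracMatrix)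
    (r : Regs) : Prop extends F.Represents P (elimBound (wordSize ws)) where
  c_eq : r.c = c
  d_eq : r.d = F.den
  Q_eq : ∀ i < c, ∀ j < c, r.Q ((i : ℤ) * c + j) = F.num i j

variable {m n : ℕ} {D : Matrix (Fin m) (Fin n) ℚ} {s : Fin m → ℚ} {ws : List ℤ} {o : ℕ} {r : Regs}

/-- Sets `Q / d` to the projection onto the null space of the transpose of the matrix in the
input. -/
def Prog.transposeProject : Prog := .project .n .m (.matEntry (.col .c) (.row .c))

theorem Loaded.exec_transposeProject (h : Loaded D s ws o r) :
    ∃ F r', Exec (limits (wordSize ws)) .transposeProject r.state r'.state ∧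
      Loaded D s ws o r' ∧ Projected (nullProj Dᵀ) ws F r' := by
  have h_le := h.add_le_wordSize
  obtain ⟨F, a, w, h_exec, hF⟩ := Exec.nullProj (N := .n) (C := .m)
    (e := .matEntry (.col .c) (.row .c)) (A := Dᵀ) h.k_eq
    (by omega : m + 1 ≤ wordSize ws) (by omega : n ≤ wordSize ws) (Int.cast_ne_zero.2 h.L_pos.ne')
    (R := fun i j => r.S (r.b + 2 * (j * r.n + i)))
    (fun i j => ⟨(h.S_mat j i).1, (h.S_mat j i).2.trans (Nat.pow_le_pow_right two_pos (by omega))⟩)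
    h.m_eq (fun _ _ _ _ _ _ => h.n_eq) fun k _ a => by simp
  exact ⟨F, _, h_exec, ⟨h.toSystemAt, h.k_eq, h.m_eq, h.n_eq, h.b_eq, h.L_pos, h.L_le, h.S_eq,
    h.S_le, h.out_eq⟩, hF, rfl, rfl, fun i hi j hj => fill_natCast_mul_add _ _ hi hj⟩

/-- Sets `Q / d` to the projection onto the null space of the matrix in the input, augmented by the
column with the entries `e`. -/
def Prog.augProject (e : Expr) : Prog :=
  .project .m (.n + 1) (Expr.isZero (.col .c - .n) * e +
    (1 - Expr.isZero (.col .c - .n)) * .matEntry (.row .c) (.col .c))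

theorem Loaded.exec_augProject (h : Loaded D s ws o r) {e : Expr} {f : ℕ → ℤ} {y : Fin m → ℚ}
    (hf : ∀ i : Fin m, (f i : ℚ) = r.L * y i ∧ (f i).natAbs ≤ 2 ^ (2 * wordSize ws + 1))
    (he : ∀ k < m * (n + 1), ∀ a,
      e.eval ({ r with c := (n + 1 : ℕ), a }.state { i := k }) = f (k / (n + 1))) :
    ∃ F r', Exec (limits (wordSize ws)) (.augProject e) r.state r'.state ∧
      Loaded D s ws o r' ∧ Projected (nullProj (augment D y)) ws F r' := by
  have h_le := h.add_le_wordSize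
  obtain ⟨F, a, w, h_exec, hF⟩ := Exec.nullProj (N := .m) (C := .n + 1)
    (e := Expr.isZero (.col .c - .n) * e +
      (1 - Expr.isZero (.col .c - .n)) * .matEntry (.row .c) (.col .c)) (A := augment D y) h.k_eq
    (by omega : n + 1 + 1 ≤ wordSize ws) (by omega) (Int.cast_ne_zero.2 h.L_pos.ne')
    (R := fun i j => if j = n then f i else r.S (r.b + 2 * (i * r.n + j)))
    (fun i j => by
      induction j using Fin.lastCases with
      | last => simpa [augment] using hf i
      | cast j =>
        simp only [augment, of_apply, Fin.snoc_castSucc, Fin.val_castSucc, if_neg j.2.ne]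
        exact ⟨(h.S_mat i j).1, (h.S_mat i j).2.trans (Nat.pow_le_pow_right two_pos (by omega))⟩)
    (by simp [h.n_eq]) (fun _ _ _ _ _ _ => h.m_eq) fun k hk a => by
      have he := he k hk a
      have h_last : ((k % (n + 1) : ℕ) : ℤ) - r.n = 0 ↔ k % (n + 1) = n := by
        rw [h.n_eq]
        omega
      simp only [Expr.eval_add, Expr.eval_mul, Expr.eval_sub, Expr.eval_isZero, Expr.eval_ofNat, he,
        Expr.eval_col, Expr.eval_row, Regs.eval_var, Regs.eval_get, Regs.varAt, Regs.arrAt,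
        ← Int.natCast_ediv, ← Int.natCast_mod, h_last]
      split_ifs <;> simp
  exact ⟨F, _, h_exec, ⟨h.toSystemAt, h.k_eq, h.m_eq, h.n_eq, h.b_eq, h.L_pos, h.L_le, h.S_eq,
    h.S_le, h.out_eq⟩, hF, rfl, rfl, fun i hi j hj => fill_natCast_mul_add _ _ hi hj⟩

/-- Sets `w` to the product of the numerators of the projection and the vector with the
entries `e`. -/
def Prog.projMul (e : Expr) : Prog := .seq (.tabulate 3 .c e) .matvec

theorem Loaded.exec_projMul (h : Loaded D s ws o r) {c : ℕ} (hc : c ≤ wordSize ws)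
    {P : Matrix (Fin c) (Fin c) ℚ} {F : FracMatrix} (hP : Projected P ws F r) {e : Expr}
    {x : Fin c → ℚ} {f : ℕ → ℤ}
    (hf : ∀ j : Fin c, (f j : ℚ) = r.L * x j ∧ (f j).natAbs ≤ 2 ^ (2 * wordSize ws))
    (he : ∀ k < c, ∀ a, e.eval ({ r with a }.state { i := k }) = f k) :
    ∃ r', Exec (limits (wordSize ws)) (.projMul e) r.state r'.state ∧ Loaded D s ws o r' ∧
      Projected P ws F r' ∧ ∀ i : Fin c, (r'.w (i : ℕ) : ℚ) = F.den * r'.L * (P *ᵥ x) i ∧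
        (r'.w (i : ℕ)).natAbs ≤ elimBound (wordSize ws) * 2 ^ (3 * wordSize ws) := by
  have h_f (j) (hj : j < c) : (f j).natAbs ≤ 2 ^ (2 * wordSize ws) := (hf ⟨j, hj⟩).2
  have h_le (i) (hi : i < c) (k) (hk : k ≤ c) :
      (F.numMulVec k f i).natAbs ≤ elimBound (wordSize ws) * 2 ^ (3 * wordSize ws) :=
    calc (F.numMulVec k f i).natAbs
        ≤ k * (elimBound (wordSize ws) * 2 ^ (2 * wordSize ws)) :=
          FracMatrix.natAbs_numMulVec_le (fun j hj => hP.num_le i hi j (hj.trans_le hk))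
            fun j hj => h_f j (hj.trans_le hk)
      _ ≤ 2 ^ wordSize ws * (elimBound (wordSize ws) * 2 ^ (2 * wordSize ws)) :=
          Nat.mul_le_mul_right _ ((hk.trans hc).trans Nat.lt_two_pow_self.le)
      _ = elimBound (wordSize ws) * 2 ^ (3 * wordSize ws) := by ring
  have h_fill := Exec.tabulate (a := 3) (N := .c) (fun a => { r with a })
    (fun _ _ _ _ => Regs.store_a _ _ _ _) (t := {}) rfl (le_limits_passes hc) f (g := r.a)
    (fun _ _ => hP.c_eq) (fun k hk => he k hk _)
    fun k hk => (h_f k hk).trans (two_pow_le_limits_bound (by omega))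
  have h_mul := Exec.matvec (r := { r with a := fill c f r.a }) hP.c_eq (le_limits_passes hc)
    hP.Q_eq (fun j hj => by simp [h.k_eq, fill_natCast _ _ hj]) fun i hi k hk =>
      (h_le i hi k hk).trans ((Nat.mul_le_mul_left _
        (Nat.pow_le_pow_right two_pos (by omega))).trans (elimBound_mul_le _))
  refine ⟨_, h_fill.seq h_mul, ⟨h.toSystemAt, h.k_eq, h.m_eq, h.n_eq, h.b_eq, h.L_pos, h.L_le,
    h.S_eq, h.S_le, h.out_eq⟩, ⟨hP.toRepresents, hP.c_eq, hP.d_eq, hP.Q_eq⟩, fun i => ?_⟩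
  have h_w : fill c (F.numMulVec c f) r.w (i : ℕ) = F.numMulVec c f i := fill_natCast _ _ i.2
  exact ⟨(congrArg Int.cast h_w).trans (hP.numMulVec_eq (fun j => (hf j).1) i),
    (congrArg Int.natAbs h_w).trans_le (h_le i i.2 c le_rfl)⟩

/-! ## Polynomial-time computability -/

/-- The numerator of an entry of the projection in `Q / d`. -/
abbrev Expr.proj (i j : Expr) : Expr := .Q (i * .c + j)

section

variable {c : ℕ} {F : FracMatrix}

theorem Projected.eval_proj {P : Matrix (Fin c) (Fin c) ℚ} (hP : Projected P ws F r) {out : List ℤ}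
    {t : Scratch} {e₁ e₂ : Expr} {i j : ℕ} (hi : i < c) (hj : j < c)
    (h₁ : e₁.eval ({ r with out }.state t) = i) (h₂ : e₂.eval ({ r with out }.state t) = j) :
    (Expr.proj e₁ e₂).eval ({ r with out }.state t) = F.num i j := by
  rw [Regs.eval_get, Expr.eval_add, Expr.eval_mul, h₁, h₂, ← hP.Q_eq i hi j hj, ← hP.c_eq]
  rfl

section

variable {P : Matrix (Fin (n + 1)) (Fin (n + 1)) ℚ}
  (h : Loaded D s ws o r) (hP : Projected P ws F r)
include h hP

theorem Loaded.eval_proj_last (out : List ℤ) (t : Scratch) :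
    (Expr.proj .n .n).eval ({ r with out }.state t) = F.num n n :=
  have h_n : Expr.n.eval ({ r with out }.state t) = n := h.n_eq
  hP.eval_proj n.lt_succ_self n.lt_succ_self h_n h_n

theorem Loaded.eval_proj_i_last (out : List ℤ) {k : ℕ} (hk : k < n) :
    (Expr.proj .i .n).eval ({ r with out }.state { i := k }) = F.num k n :=
  have h_n : Expr.n.eval ({ r with out }.state { i := k }) = n := h.n_eq
  hP.eval_proj (hk.trans n.lt_succ_self) n.lt_succ_self rfl h_n

theorem Loaded.eval_schurNum (out : List ℤ) {k : ℕ} (hk : k < n * n) :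
    (Expr.proj .n .n * .proj (.row .n) (.col .n) - .proj (.row .n) .n * .proj (.col .n) .n).eval
      ({ r with out }.state { i := k }) = F.schurNum n (k / n) (k % n) := by
  have h_row_lt : k / n < n + 1 := (Nat.div_lt_of_lt_mul hk).trans n.lt_succ_self
  have h_col_lt : k % n < n + 1 :=
    (Nat.mod_lt _ (Nat.pos_of_mul_pos_left (Nat.zero_lt_of_lt hk))).trans n.lt_succ_self
  have h_n : Expr.n.eval ({ r with out }.state { i := k }) = n := h.n_eq
  have h_row : (Expr.row .n).eval ({ r with out }.state { i := k }) = (k / n : ℕ) := by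
    rw [Expr.eval_row, h_n, Int.natCast_ediv]
  have h_col : (Expr.col .n).eval ({ r with out }.state { i := k }) = (k % n : ℕ) := by
    rw [Expr.eval_col, h_n, Int.natCast_mod]
  rw [Expr.eval_sub, Expr.eval_mul, Expr.eval_mul, h.eval_proj_last hP,
    hP.eval_proj h_row_lt h_col_lt h_row h_col, hP.eval_proj h_row_lt n.lt_succ_self h_row h_n,
    hP.eval_proj h_col_lt n.lt_succ_self h_col h_n, FracMatrix.schurNum]

end

/-- Writes the null projection and the particular solution for the system in the input. -/
def Prog.writeToMU : Prog :=
  .outSystem .n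
    (.proj .n .n * .proj (.row .n) (.col .n) - .proj (.row .n) .n * .proj (.col .n) .n)
    (.d * .proj .n .n) (0 - .proj .i .n) (.proj .n .n)

theorem Loaded.exec_writeToMU (h : Loaded D s ws o r)
    (hP : Projected (nullProj (augment D s)) ws F r) (hs : ∃ v, D *ᵥ v = s) :
    ∃ σ, Exec (limits (wordSize ws)) .writeToMU r.state σ ∧
      σ.out = encSystem (nullProj D) (particular D s) := by
  have h_le := h.add_le_wordSize
  have h_num_le {i : ℕ} (hi : i ≤ n) : (F.num i n).natAbs ≤ (limits (wordSize ws)).bound :=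
    (hP.natAbs_num_le hi le_rfl).trans (elimBound_le _)
  exact ⟨_, Exec.outSystem h.out_eq (add_le_limits_passes (by omega) (by omega))
    (mul_le_limits_passes (by omega) (by omega)) (fun _ _ => h.n_eq) (numA := F.schurNum n)
    (numY := fun i => -F.num i n) (fun k hk out => h.eval_schurNum hP out hk)
    (fun _ _ out _ => congrArg₂ (· * ·) hP.d_eq (h.eval_proj_last hP out _))
    (fun k hk out => by
      rw [Expr.eval_sub, h.eval_proj_i_last hP out hk]
      exact zero_sub _)
    (fun _ _ out _ => h.eval_proj_last hP out _)
    (mul_pos hP.den_pos (hP.num_last_pos hs)) (hP.num_last_pos hs)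
    (fun i hi j hj => (hP.natAbs_schurNum_le hi.le hj.le).trans
      (elimBound_sq_mul_le (Nat.le_self_pow (by omega) 2)))
    (hP.natAbs_den_mul_num_le.trans ((Nat.mul_one _).ge.trans
      (elimBound_sq_mul_le Nat.one_le_two_pow)))
    (fun k hk => (Int.natAbs_neg _).trans_le (h_num_le hk.le)) (h_num_le le_rfl)
    (hP.schurNum_eq hs) (hP.neg_num_eq hs), rfl⟩

/-- Writes the particular solution for the system whose augmented matrix has been projected. -/
def Prog.writeParticular : Prog := .outVec .n (0 - .proj .i .n) (.proj .n .n)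

theorem Loaded.exec_writeParticular (h : Loaded D s ws o r) {y : Fin m → ℚ}
    (hP : Projected (nullProj (augment D y)) ws F r) (hy : ∃ v, D *ᵥ v = y) :
    ∃ σ, Exec (limits (wordSize ws)) .writeParticular r.state σ ∧
      σ.out = encVec (particular D y) := by
  have h_le := h.add_le_wordSize
  have h_num_le {i : ℕ} (hi : i ≤ n) : (F.num i n).natAbs ≤ (limits (wordSize ws)).bound :=
    (hP.natAbs_num_le hi le_rfl).trans (elimBound_le _)
  exact ⟨_, Exec.outVec h.out_eq (le_limits_passes (by omega)) (num := fun i => -F.num i n)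
    (fun _ _ => h.n_eq)
    (fun k hk out => by
      rw [Expr.eval_sub, h.eval_proj_i_last hP out hk]
      exact zero_sub _)
    (fun _ _ out _ => h.eval_proj_last hP out _) (hP.num_last_pos hy)
    (fun k hk => (Int.natAbs_neg _).trans_le (h_num_le hk.le)) (h_num_le le_rfl)
    (hP.neg_num_eq hy), rfl⟩

/-- Writes the particular solution for the system in the input, less the projection of the vector
that has been multiplied into `w`. -/
def Prog.writeSol : Prog :=
  .outVec .n (0 - (.proj .i .n * (.d * .L - .w .n) + .proj .n .n * .w .i)) (.d * .L * .proj .n .n)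

theorem Loaded.exec_writeSol (h : Loaded D s ws o r)
    (hP : Projected (nullProj (augment D s)) ws F r) (hs : ∃ v, D *ᵥ v = s) {x : Fin n → ℚ}
    (hw : ∀ i : Fin (n + 1), (r.w (i : ℕ) : ℚ) = F.den * r.L *
        (nullProj (augment D s) *ᵥ (Fin.snoc x 0 : Fin (n + 1) → ℚ)) i ∧
      (r.w (i : ℕ)).natAbs ≤ elimBound (wordSize ws) * 2 ^ (3 * wordSize ws)) :
    ∃ σ, Exec (limits (wordSize ws)) .writeSol r.state σ ∧
      σ.out = encVec (particular D s - nullProj D *ᵥ x) := by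
  have h_le := h.add_le_wordSize
  have h_L : r.L.natAbs ≤ 2 ^ (3 * wordSize ws) :=
    h.L_le.trans (Nat.pow_le_pow_right two_pos (by omega))
  have h_pow : 3 * 2 ^ (3 * wordSize ws) ≤ 2 ^ (3 * wordSize ws + 3) := by
    rw [pow_add]
    omega
  have h_den_le : (F.den * r.L * F.num n n).natAbs ≤
      elimBound (wordSize ws) ^ 2 * 2 ^ (3 * wordSize ws) := by
    rw [mul_right_comm, Int.natAbs_mul]
    exact Nat.mul_le_mul hP.natAbs_den_mul_num_le h_L
  exact ⟨_, Exec.outVec h.out_eq (le_limits_passes (by omega))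
    (num := F.solNum n r.L fun i => r.w i) (fun _ _ => h.n_eq)
    (fun k hk out => by
      have h_w : (Expr.w .n).eval ({ r with out }.state { i := k }) = r.w n := by
        rw [← h.n_eq]
        rfl
      have h_d : Expr.d.eval ({ r with out }.state { i := k }) = F.den := hP.d_eq
      rw [Expr.eval_sub, Expr.eval_add, Expr.eval_mul, Expr.eval_mul, Expr.eval_sub, Expr.eval_mul,
        h.eval_proj_i_last hP out hk, h.eval_proj_last hP, h_w, h_d]
      exact zero_sub _)
    (fun _ _ out _ => by
      rw [Expr.eval_mul, Expr.eval_mul, h.eval_proj_last hP, ← hP.d_eq]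
      rfl)
    (mul_pos (mul_pos hP.den_pos h.L_pos) (hP.num_last_pos hs))
    (fun k hk => (hP.natAbs_solNum_le h_L (fun i hi => (hw ⟨i, Nat.lt_succ_of_le hi⟩).2)
      hk.le).trans (elimBound_sq_mul_le h_pow))
    (h_den_le.trans (elimBound_sq_mul_le (by omega)))
    (hP.solNum_eq hs fun i => (hw i).1), rfl⟩

/-- Writes the projection and the vector `w`, with the denominator `d * L`. -/
def Prog.writeToEDR : Prog := .outSystem .m (.Q .i) .d (.w .i) (.d * .L)

theorem Loaded.exec_writeToEDR (h : Loaded D s ws o r) {P : Matrix (Fin m) (Fin m) ℚ}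
    (hP : Projected P ws F r) {y : Fin m → ℚ}
    (hw : ∀ i : Fin m, (r.w (i : ℕ) : ℚ) = F.den * r.L * (P *ᵥ y) i ∧
      (r.w (i : ℕ)).natAbs ≤ elimBound (wordSize ws) * 2 ^ (3 * wordSize ws)) :
    ∃ σ, Exec (limits (wordSize ws)) .writeToEDR r.state σ ∧ σ.out = encSystem P (P *ᵥ y) := by
  have h_le := h.add_le_wordSize
  have h_bound : elimBound (wordSize ws) * 2 ^ (3 * wordSize ws) ≤ (limits (wordSize ws)).bound :=
    (Nat.mul_le_mul_left _ (Nat.pow_le_pow_right two_pos (by omega))).trans (elimBound_mul_le _)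
  exact ⟨_, Exec.outSystem h.out_eq (add_le_limits_passes (by omega) (by omega))
    (mul_le_limits_passes (by omega) (by omega)) (fun _ _ => h.m_eq) (numA := F.num)
    (numY := fun i => r.w i)
    (fun k hk _ => by
      have h_Q := hP.Q_eq (k / m) (Nat.div_lt_of_lt_mul hk) (k % m)
        (Nat.mod_lt _ (Nat.pos_of_mul_pos_left (Nat.zero_lt_of_lt hk)))
      rwa [← Nat.cast_mul, ← Nat.cast_add, Nat.div_add_mod'] at h_Q)
    (fun _ _ _ _ => hP.d_eq) (fun _ _ _ => rfl)
    (fun _ _ _ _ => congrArg (· * r.L) hP.d_eq) hP.den_pos (mul_pos hP.den_pos h.L_pos)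
    (fun i hi j hj => (hP.num_le i hi j hj).trans (elimBound_le _))
    (hP.den_le.trans (elimBound_le _)) (fun k hk => (hw ⟨k, hk⟩).2.trans h_bound)
    ((Int.natAbs_mul _ _).trans_le ((Nat.mul_le_mul hP.den_le (h.L_le.trans
      (Nat.pow_le_pow_right two_pos (by omega)))).trans h_bound))
    hP.num_eq (fun i => by rw [(hw i).1]; push_cast; ring), rfl⟩

end

theorem polyTime_toMU : PolyTime EDR.encInst fun I => MU.encInst (EDRInst.toMU I) := by
  refine polyTime_of_exec_limits
    (.seq (.read 0) (.seq (.augProject (.vecEntry (.row .c))) .writeToMU)) fun I => ?_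
  obtain ⟨r, h_read, h⟩ := (systemAt_encSystem I.D I.s).exists_loaded (e := 0) fun _ => rfl
  obtain ⟨F, r', h_proj, h', hP⟩ := h.exec_augProject (e := .vecEntry (.row .c))
    (f := fun i => r.S (r.b + 2 * (r.m * r.n + i)))
    (fun i => ⟨(h.S_vec i).1, (h.S_vec i).2.trans (Nat.pow_le_pow_right two_pos (by omega))⟩)
    fun k _ a => by simp
  obtain ⟨σ, h_write, h_out⟩ := h'.exec_writeToMU hP I.exists_mulVec_eq
  exact ⟨σ, h_read.seq (h_proj.seq h_write), h_out⟩

theorem polyTime_ofMUSol : PolyTime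
    (fun p : (I : EDRInst) × (Fin I.n → ℚ) => encPair (EDR.encInst p.1) (encVec p.2))
    fun p => encVec (p.1.ofMUSol p.2).1 := by
  refine polyTime_of_exec_limits (.seq (.read 1) (.seq (.augProject (.vecEntry (.row .c)))
    (.seq (.projMul ((1 - Expr.isZero (.i - .n)) * .solEntry .i)) .writeSol))) fun ⟨I, x⟩ => ?_
  obtain ⟨r, h_read, h⟩ := (systemAt_encPair I.D I.s (encVec x)).exists_loaded (e := 1) fun _ => rfl
  obtain ⟨F, r', h_proj, h', hP⟩ := h.exec_augProject (e := .vecEntry (.row .c))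
    (f := fun i => r.S (r.b + 2 * (r.m * r.n + i)))
    (fun i => ⟨(h.S_vec i).1, (h.S_vec i).2.trans (Nat.pow_le_pow_right two_pos (by omega))⟩)
    fun k _ a => by simp
  have h_le := h.add_le_wordSize
  obtain ⟨r'', h_mul, h'', hP', hw⟩ := h'.exec_projMul (by omega) hP
    (e := (1 - Expr.isZero (.i - .n)) * .solEntry .i) (x := Fin.snoc x 0)
    (f := fun i => if i = I.n then 0 else r'.S (r'.b + 2 * (r'.m * r'.n + r'.m) + 1 + 2 * i))
    (fun i => by
      induction i using Fin.lastCases with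
      | last => simp
      | cast i =>
        simp only [Fin.snoc_castSucc, Fin.val_castSucc, if_neg i.2.ne]
        exact h'.S_sol (vecAt_encPair I.D I.s x) i)
    fun k _ a => by
      have h_last : (k : ℤ) - r'.n = 0 ↔ k = I.n := by
        rw [h'.n_eq]
        omega
      simp only [Expr.eval_add, Expr.eval_mul, Expr.eval_sub, Expr.eval_isZero, Expr.eval_ofNat,
        Regs.eval_var, Regs.eval_get, Regs.varAt, Regs.arrAt, h_last]
      split_ifs <;> simp
  obtain ⟨σ, h_write, h_out⟩ := h''.exec_writeSol hP' I.exists_mulVec_eq hw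
  exact ⟨σ, h_read.seq (h_proj.seq (h_mul.seq h_write)), h_out⟩

theorem polyTime_toEDR : PolyTime MU.encInst fun I => EDR.encInst (MUInst.toEDR I) := by
  refine polyTime_of_exec_limits (.seq (.read 0) (.seq .transposeProject
    (.seq (.projMul (.vecEntry .i)) .writeToEDR))) fun I => ?_
  obtain ⟨r, h_read, h⟩ := (systemAt_encSystem I.A I.y).exists_loaded (e := 0) fun _ => rfl
  obtain ⟨F, r', h_proj, h', hP⟩ := h.exec_transposeProject
  have h_le := h.add_le_wordSize
  obtain ⟨r'', h_mul, h'', hP', hw⟩ := h'.exec_projMul (by omega) hP (e := .vecEntry .i)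
    (f := fun i => r'.S (r'.b + 2 * (r'.m * r'.n + i))) h'.S_vec fun k _ a => by simp
  obtain ⟨σ, h_write, h_out⟩ := h''.exec_writeToEDR hP' hw
  exact ⟨σ, h_read.seq (h_proj.seq (h_mul.seq h_write)), h_out⟩

theorem polyTime_ofEDRSol : PolyTime
    (fun p : (I : MUInst) × {v : Fin I.m → ℚ // nullProj I.Aᵀ *ᵥ v = nullProj I.Aᵀ *ᵥ I.y} =>
      encPair (MU.encInst p.1) (encVec p.2.1))
    fun p => encVec (p.1.ofEDRSol p.2) := by
  refine polyTime_of_exec_limits (.seq (.read 1)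
    (.seq (.augProject (.vecEntry (.row .c) - .solEntry (.row .c))) .writeParticular))
    fun ⟨I, v⟩ => ?_
  obtain ⟨r, h_read, h⟩ :=
    (systemAt_encPair I.A I.y (encVec v.1)).exists_loaded (e := 1) fun _ => rfl
  have h_sol := h.S_sol (vecAt_encPair I.A I.y v.1)
  obtain ⟨F, r', h_proj, h', hP⟩ := h.exec_augProject (y := I.y - v.1)
    (e := .vecEntry (.row .c) - .solEntry (.row .c))
    (f := fun i => r.S (r.b + 2 * (r.m * r.n + i)) -
      r.S (r.b + 2 * (r.m * r.n + r.m) + 1 + 2 * i))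
    (fun i => ⟨by rw [Int.cast_sub, (h.S_vec i).1, (h_sol i).1, Pi.sub_apply, mul_sub],
      (Int.natAbs_sub_le _ _).trans ((Nat.add_le_add (h.S_vec i).2 (h_sol i).2).trans_eq
        (by rw [pow_succ, Nat.mul_two]))⟩)
    fun k _ a => by simp
  obtain ⟨σ, h_write, h_out⟩ := h'.exec_writeParticular hP (I.exists_mulVec_eq v)
  exact ⟨σ, h_read.seq (h_proj.seq h_write), h_out⟩

end RAM

theorem mainTheorem6 :
    MinProblem.Equivalent EDR MU ∧
    (∃ (k : EDRInst → ℕ) (A : ∀ I : EDRInst, Matrix (Fin I.n) (Fin (k I)) ℚ)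
        (y : ∀ I : EDRInst, Fin I.n → ℚ)
        (t₂ : ∀ I : EDRInst, (Fin (k I) → ℚ) → {v : Fin I.n → ℚ // I.D *ᵥ v = I.s}),
      MinProblem.IsExactReduction EDR MU (fun I => MUInst.mk I.n (k I) (A I) (y I)) t₂ ∧
      (∀ I : EDRInst, IsFullNullMatrix I.D (A I) ∧ I.D *ᵥ y I = I.s) ∧
      (∀ (I : EDRInst) (x : Fin (k I) → ℚ), (t₂ I x).1 = y I - A I *ᵥ x)) ∧
    (∃ (p : MUInst → ℕ) (D : ∀ I : MUInst, Matrix (Fin (p I)) (Fin I.m) ℚ)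
        (t₂ : ∀ I : MUInst,
          {v : Fin I.m → ℚ // D I *ᵥ v = D I *ᵥ I.y} → (Fin I.n → ℚ)),
      MinProblem.IsExactReduction MU EDR (fun I => EDRInst.ofVec (D I) I.y) t₂ ∧
      (∀ I : MUInst, IsFullNullMatrix (D I) I.A) ∧
      (∀ (I : MUInst) (v : {v : Fin I.m → ℚ // D I *ᵥ v = D I *ᵥ I.y}),
        I.A *ᵥ t₂ I v = I.y - v.1)) := by
  have h₁ := EDRInst.isExactReduction RAM.polyTime_toMU RAM.polyTime_ofMUSol
  have h₂ := MUInst.isExactReduction RAM.polyTime_toEDR RAM.polyTime_ofEDRSol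
  exact ⟨⟨⟨_, _, h₁⟩, ⟨_, _, h₂⟩⟩,
    ⟨_, _, _, _, h₁,
      fun I => ⟨isFullNullMatrix_nullProj I.D, mulVec_particular I.exists_mulVec_eq⟩,
      fun _ _ => rfl⟩,
    ⟨_, _, _, h₂, fun I => isFullNullMatrix_nullProj_transpose I.A, MUInst.mulVec_ofEDRSol⟩⟩
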